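/- Let $I\subseteq\,]0,\infty[$ have $0$ as a limit point, let $S$ be a finite set, and let $p=(p_\epsilon)_{\epsilon\in I}$ be a perturbation on $S$, i.e. a family of stochastic matrices on $S$. For $f,g:I\to\mathbb{R}_{\ge 0}$ write $f\precsim g$ if there are $b,\epsilon_0>0$ with $f(\epsilon)\le b\,g(\epsilon)$ for all $\epsilon\in I$ with $\epsilon<\epsilon_0$, and $f\cong g$ if $f\precsim g$ and $g\precsim f$. Write $p(x,y)$ for the map $\epsilon\mapsto p_\epsilon(x,y)$. Assume (Assumption 1) that the multiplicative closure of the maps $p(x,y)$ with $x\neq y$ is totally preordered by $\precsim$. The essential graph on $S$ has an arc $(x,y)$ when $x\ne y$ and $p(z,t)\precsim p(x,y)$ for all $z,t\in S$; the essential classes are its sink strongly connected components. Let $E$ be an essential class and $x\in E$. The essential collapse $\tilde p=\kappa(p,x)$ is the family of matrices on $\tilde S=(S\setminus E)\cup\{\cup E\}$ (where $\cup E$ is one new state) given, for $y,z\in S\setminus E$, by $$\tilde p(\cup E,\cup E)=\mathbb{P}^x(X_{\tau}=x),\quad \tilde p(\cup E,y)=\mathbb{P}^x(X_{\tau}=y),\quad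 \tilde p(y,\cup E)=\sum_{t\in E}p(y,t),\quad \tilde p(y,z)=p(y,z),$$ where $X$ is the Markov chain of matrix $p_\epsilon$ started at $x$ and $\tau=\inf\{n>0: X_n\in (S\setminus E)\cup\{x\}\}$ (the events require $\tau<\infty$). A stationary distribution map of a family $(q_\epsilon)_{\epsilon\in J}$ is a family $(\mu_\epsilon)_{\epsilon\in J}$ such that each $\mu_\epsilon$ is a stationary distribution of $q_\epsilon$; a state $y$ is stable for $(q_\epsilon)_{\epsilon\in J}$ if some stationary distribution map satisfies $\liminf_{\epsilon\to0}\mu_\epsilon(y)>0$. Then there is $\delta>0$ such that $\tilde p_\epsilon$ is a stochastic matrix for all $\epsilon\in I$ with $\epsilon<\delta$. Moreover, let $J\subseteq I$ contain $I\cap\,]0,\eta[$ for some $\eta>0$ and be such that $\tilde p_\epsilon$ is stochastic for all $\epsilon\in J$ (possibly $J=I$). Then: 1. For every stationary distribution map $\mu$ of $(p_\epsilon)_{\epsilon\in J}$ there is a stationary distribution map $\tilde\mu$ of $(\tilde p_\epsilon)_{\epsilon\in J}$, and conversely for every stationary distribution map $\tilde\mu$ of $(\tilde p_\epsilon)_{\epsilon\in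 J}$ there is a stationary distribution map $\mu$ of $(p_\epsilon)_{\epsilon\in J}$, such that $\tilde\mu(\cup E)\cong\mu(x)$ and $\tilde\mu(y)\cong\mu(y)$ for all $y\in S\setminus E$. 2. A state $y\in S$ is stable for $p=(p_\epsilon)_{\epsilon\in I}$ iff either $y\in E$ and $\cup E$ is stable for $(\tilde p_\epsilon)_{\epsilon\in J}$, or $y\notin E$ and $y$ is stable for $(\tilde p_\epsilon)_{\epsilon\in J}$. -/

import Mathlib

open Filter Topology MeasureTheory ProbabilityTheory

noncomputable section

/-! ### The law of a finite Markov chain -/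

/-- The one-step law out of the state `x` for a stochastic matrix `P`. -/
def stepPMF {S : Type*} [Fintype S] [DecidableEq S] (P : Matrix S S ℝ)
    (hP : P ∈ Matrix.rowStochastic ℝ S) (x : S) : PMF S :=
  PMF.ofFintype (fun y => ENNReal.ofReal (P x y)) (by
    rw [← ENNReal.ofReal_sum_of_nonneg (fun y _ => hP.1 x y),
      Matrix.sum_row_of_mem_rowStochastic hP x, ENNReal.ofReal_one])

/-- The transition kernel of the chain at time `n`: given the states at the times `0, …, n`,
the next state has law `stepPMF` out of the state at time `n`. All sets of states are
measurable. -/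
def stepKernel {S : Type*} [Fintype S] [DecidableEq S] [MeasurableSpace S]
    [MeasurableSingletonClass S] (P : Matrix S S ℝ) (hP : P ∈ Matrix.rowStochastic ℝ S) (n : ℕ) :
    Kernel (Finset.Iic n → S) S :=
  Kernel.ofFunOfCountable (fun h => (stepPMF P hP (h ⟨n, Finset.mem_Iic.2 le_rfl⟩)).toMeasure)

instance stepKernel.instIsMarkovKernel {S : Type*} [Fintype S] [DecidableEq S]
    [MeasurableSpace S] [MeasurableSingletonClass S] (P : Matrix S S ℝ)
    (hP : P ∈ Matrix.rowStochastic ℝ S) (n : ℕ) : IsMarkovKernel (stepKernel P hP n) :=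
  ⟨fun h => PMF.toMeasure.isProbabilityMeasure
    (stepPMF P hP (h ⟨n, Finset.mem_Iic.2 le_rfl⟩))⟩

/-- `ℙ^x`: the law, on the space of trajectories `ℕ → S`, of the Markov chain with transition
matrix `P` started at the state `x`. -/
def chainLaw {S : Type*} [Fintype S] [DecidableEq S] [MeasurableSpace S]
    [MeasurableSingletonClass S] (P : Matrix S S ℝ) (hP : P ∈ Matrix.rowStochastic ℝ S) (x : S) :
    Measure (ℕ → S) :=
  Kernel.trajMeasure (X := fun _ => S) (Measure.dirac x) (stepKernel P hP)

/-- `τ⁺_A`: the first positive time at which the trajectory `ω` is in `A` (`⊤` if there is none). -/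
def hitTimePos {S : Type*} (A : Set S) (ω : ℕ → S) : ℕ∞ :=
  ⨅ n : {n : ℕ // 0 < n ∧ ω n ∈ A}, ((n : ℕ) : ℕ∞)

/-- `ℙ^x (X_{τ⁺_A} = y)`: the probability, starting from `x`, that `τ⁺_A` is finite and that the
chain is at `y` at that time. -/
def hitProb {S : Type*} [Fintype S] [DecidableEq S] (P : Matrix S S ℝ)
    (hP : P ∈ Matrix.rowStochastic ℝ S) (x : S) (A : Set S) (y : S) : ℝ :=
  letI : MeasurableSpace S := ⊤
  (chainLaw P hP x).real {ω | ∃ n : ℕ, hitTimePos A ω = n ∧ ω n = y}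

/-! ### Comparison of maps on the parameter set -/

/-- `f ≾ g`: there are positive `b`, `ε₀` with `f ε ≤ b * g ε` for all `ε ∈ I`, `ε < ε₀`. -/
def Dominated {I : Set ℝ} (f g : I → ℝ) : Prop :=
  ∃ b : ℝ, 0 < b ∧ ∃ ε₀ : ℝ, 0 < ε₀ ∧ ∀ ε : I, (ε : ℝ) < ε₀ → f ε ≤ b * g ε

/-- `f ≅ g`: `f ≾ g` and `g ≾ f`. -/
def Equivalent {I : Set ℝ} (f g : I → ℝ) : Prop :=
  Dominated f g ∧ Dominated g f

/-- The filter on `I` describing `ε → 0`, `ε ∈ I`. -/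
def nearZero (I : Set ℝ) : Filter I :=
  comap ((↑) : I → ℝ) (𝓝 0)

/-! ### Families of transition matrices, stationary distribution maps and stability -/

/-- On the set `J` of parameters, `q` consists of stochastic matrices. -/
def IsStochasticOn {S : Type*} [Fintype S] [DecidableEq S] {I : Set ℝ} (J : Set I)
    (q : I → Matrix S S ℝ) : Prop :=
  ∀ ε ∈ J, q ε ∈ Matrix.rowStochastic ℝ S

/-- On the set `J` of parameters, `μ` consists of stationary distributions of `q`. -/
def IsStationaryMapOn {S : Type*} [Fintype S] {I : Set ℝ} (J : Set I)
    (q : I → Matrix S S ℝ) (μ : I → S → ℝ) : Prop :=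
  ∀ ε ∈ J, μ ε ∈ stdSimplex ℝ S ∧ Matrix.vecMul (μ ε) (q ε) = μ ε

/-- The state `y` is stochastically stable for the family `(q ε)`, `ε ∈ J`, where `J` contains all
the parameters in `I` that are close to `0`. -/
def IsStableOn {S : Type*} [Fintype S] {I : Set ℝ} (J : Set I)
    (q : I → Matrix S S ℝ) (y : S) : Prop :=
  ∃ μ : I → S → ℝ, IsStationaryMapOn J q μ ∧ 0 < liminf (fun ε => μ ε y) (nearZero I)

/-- A perturbation: a family of (transition matrices of) Markov chains on the same finite state
space, indexed by a set `I` of positive reals that has `0` as a limit point. -/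
structure Perturbation (S : Type*) [Fintype S] [DecidableEq S] where
  /-- the set of parameters -/
  I : Set ℝ
  pos : ∀ ε ∈ I, 0 < ε
  limitPoint : AccPt (0 : ℝ) (𝓟 I)
  /-- the transition matrices -/
  p : I → Matrix S S ℝ
  stochastic : ∀ ε : I, p ε ∈ Matrix.rowStochastic ℝ S

namespace Perturbation

/-- The map `ε ↦ p_ε(x, y)`. -/
def map {S : Type*} [Fintype S] [DecidableEq S] (X : Perturbation S) (x y : S) : X.I → ℝ :=
  fun ε => X.p ε x y

/-- The multiplicative closure of the maps `p(x, y)` with `x ≠ y` is totally preordered by `≾`. -/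
def TotallyPreordered {S : Type*} [Fintype S] [DecidableEq S] (X : Perturbation S) : Prop :=
  ∀ f ∈ Subsemigroup.closure {h : X.I → ℝ | ∃ x y : S, x ≠ y ∧ h = X.map x y},
    ∀ g ∈ Subsemigroup.closure {h : X.I → ℝ | ∃ x y : S, x ≠ y ∧ h = X.map x y},
      Dominated f g ∨ Dominated g f

/-- The arcs of the essential graph. -/
def EssentialArc {S : Type*} [Fintype S] [DecidableEq S] (X : Perturbation S) (x y : S) : Prop :=
  x ≠ y ∧ ∀ z t : S, Dominated (X.map z t) (X.map x y)

/-- There is a (possibly empty) path from `x` to `y` in the essential graph. -/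
def EssentialReach {S : Type*} [Fintype S] [DecidableEq S] (X : Perturbation S) : S → S → Prop :=
  Relation.ReflTransGen X.EssentialArc

/-- The essential classes: the sink strongly connected components of the essential graph. -/
structure IsEssentialClass {S : Type*} [Fintype S] [DecidableEq S] (X : Perturbation S)
    (E : Finset S) : Prop where
  nonempty : E.Nonempty
  isSCC : ∀ y ∈ E, ∀ z, z ∈ E ↔ X.EssentialReach y z ∧ X.EssentialReach z y
  sink : ∀ y ∈ E, ∀ z, X.EssentialArc y z → z ∈ E

/-- The essential collapse `κ(p, x)` of a perturbation around a state `x` of the class `E`. The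
state space `(S \ E) ∪ {∪E}` is `Option {y // y ∉ E}`, where `none` stands for the meta-state `∪E`
and `some y` for the state `y ∉ E`. -/
def collapse {S : Type*} [Fintype S] [DecidableEq S] (X : Perturbation S) (E : Finset S) (x : S) :
    X.I → Matrix (Option {y : S // y ∉ E}) (Option {y : S // y ∉ E}) ℝ :=
  fun ε s t => match s, t with
    | none, none => hitProb (X.p ε) (X.stochastic ε) x ({y | y ∉ E} ∪ {x}) x
    | none, some y => hitProb (X.p ε) (X.stochastic ε) x ({y | y ∉ E} ∪ {x}) y
    | some y, none => ∑ z ∈ E, X.p ε y z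
    | some y, some z => X.p ε y z

end Perturbation

end

/-! An essential arc dominates every entry of its row, and the row sums to one, so near zero its
probability is at least some c > 0. Since E is strongly connected by such arcs and closed under
them, there is a > 0, independent of ε, such that from each t in E the chain reaches x before
leaving E with probability at least a, and each exit law from t is at most 1/a times the exit law
from x. Likewise, all states of E have comparable stationary mass.

Put F = E \ {x} and let W be the trace of the chain on the complement of F. Stationary measures of P
restrict to stationary measures of the trace, and those of the trace extend to P
(`IsTrace.vecMul_collapsedTrace`, `IsTrace.exists_vecMul_eq`). It remains to compare the trace with
the collapse. Their rows at x agree and their columns at x are comparable. The other entries need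
not be: the trace sees passages y → F → z that the collapse records only as passages through the
state ∪E. They become comparable once that state is eliminated.

The comparison of stationary measures is therefore done by eliminating states one at a time, as in
Gaussian elimination (`isBalanced_insert_iff`). Jump rates comparable within a factor C stay
comparable under elimination, and the mass of the eliminated state is recovered from its own balance
equation; the final factor depends only on C and the state set (`balancedComparison`,
`BalancedComparison.insert_aux`). Stationary measures need not be unique, so each comparison
produces a partner for a given measure. Normalization costs a bounded factor, because the mass of F
is at most a multiple of that of x. -/

/-- The matrix `P` with the rows outside `F` replaced by zero. -/
noncomputable def restrictRows {S : Type*} [DecidableEq S] (P : Matrix S S ℝ) (F : Finset S) :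
    Matrix S S ℝ :=
  Matrix.of fun s t => if s ∈ F then P s t else 0

lemma measurableSet_taboo {S : Type*} [Fintype S] [MeasurableSpace S]
    [MeasurableSingletonClass S] (A : Set S) (n : ℕ) (y : S) :
    MeasurableSet {ω : ℕ → S | (∀ k, 0 < k → k < n → ω k ∉ A) ∧ ω n = y} := by
  have hA : MeasurableSet Aᶜ := A.toFinite.measurableSet.compl
  have : {ω : ℕ → S | (∀ k, 0 < k → k < n → ω k ∉ A) ∧ ω n = y} =
      (⋂ k, ⋂ (_ : 0 < k), ⋂ (_ : k < n), (fun ω : ℕ → S => ω k) ⁻¹' Aᶜ) ∩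
        (fun ω : ℕ → S => ω n) ⁻¹' {y} := by
    ext ω; simp
  rw [this]
  exact (MeasurableSet.iInter fun k => MeasurableSet.iInter fun _ => MeasurableSet.iInter fun _ =>
    measurable_pi_apply k hA).inter (measurable_pi_apply n (measurableSet_singleton y))

/-! ### Taboo probabilities of the chain -/

section ChainLaw

variable {S : Type*} [Fintype S] [DecidableEq S] [MeasurableSpace S] [MeasurableSingletonClass S]
  (P : Matrix S S ℝ) (hP : P ∈ Matrix.rowStochastic ℝ S)

instance chainLaw.instIsProbabilityMeasure (x : S) : IsProbabilityMeasure (chainLaw P hP x) := by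
  unfold chainLaw
  infer_instance

lemma chainLaw_zero (x : S) : (chainLaw P hP x) {ω | ω 0 = x} = 1 := by
  have h1 : (chainLaw P hP x).map (Preorder.frestrictLe (π := fun _ => S) 0) =
      (Measure.dirac x).map (MeasurableEquiv.piUnique (fun _ : Finset.Iic 0 => S)).symm := by
    unfold chainLaw Kernel.trajMeasure
    rw [Measure.map_comp _ _ (by fun_prop), Kernel.traj_map_frestrictLe, Kernel.partialTraj_self,
      Measure.id_comp]
  have h2 : {ω : ℕ → S | ω 0 = x} =
      Preorder.frestrictLe (π := fun _ => S) 0 ⁻¹' {h | h ⟨0, Finset.mem_Iic.2 le_rfl⟩ = x} := rfl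
  have hm : MeasurableSet {h : Finset.Iic 0 → S | h ⟨0, Finset.mem_Iic.2 le_rfl⟩ = x} :=
    Set.Finite.measurableSet (Set.toFinite _)
  rw [h2, ← Measure.map_apply (by fun_prop) hm, h1,
    Measure.map_apply (MeasurableEquiv.measurable _) hm, Measure.dirac_apply']
  · rw [Set.indicator_of_mem]
    · rfl
    · rfl
  · exact MeasurableEquiv.measurable _ hm

/-- The Markov property at time `n`. -/
lemma chainLaw_succ (x s y : S) (n : ℕ) {G : Set (Finset.Iic n → S)} (hG : MeasurableSet G)
    (hs : ∀ h ∈ G, h ⟨n, Finset.mem_Iic.2 le_rfl⟩ = s) :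
    (chainLaw P hP x).real {ω | Preorder.frestrictLe (π := fun _ => S) n ω ∈ G ∧ ω (n + 1) = y} =
      (chainLaw P hP x).real {ω | Preorder.frestrictLe (π := fun _ => S) n ω ∈ G} * P s y := by
  have key := Kernel.map_frestrictLe_trajMeasure_compProd_eq_map_trajMeasure
    (X := fun _ => S) (μ₀ := Measure.dirac x) (κ := stepKernel P hP) (a := n)
  have e1 : {ω : ℕ → S | Preorder.frestrictLe (π := fun _ => S) n ω ∈ G ∧ ω (n + 1) = y} =
      (fun ω : ℕ → S => (Preorder.frestrictLe (π := fun _ => S) n ω, ω (n + 1))) ⁻¹' (G ×ˢ {y}) := by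
    ext ω; simp
  have hmeas : MeasurableSet (G ×ˢ ({y} : Set S)) := hG.prod (measurableSet_singleton y)
  have e2 : (chainLaw P hP x) {ω | Preorder.frestrictLe (π := fun _ => S) n ω ∈ G ∧ ω (n + 1) = y} =
      ENNReal.ofReal (P s y) *
        (chainLaw P hP x) {ω | Preorder.frestrictLe (π := fun _ => S) n ω ∈ G} := by
    rw [e1, ← Measure.map_apply (by fun_prop) hmeas]
    unfold chainLaw
    rw [← key, Measure.compProd_apply_prod hG (measurableSet_singleton y),
      setLIntegral_congr_fun (g := fun _ => ENNReal.ofReal (P s y)) hG, setLIntegral_const,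
      Measure.map_apply (by fun_prop) hG]
    · rfl
    · intro h hh
      change (stepPMF P hP (h ⟨n, Finset.mem_Iic.2 le_rfl⟩)).toMeasure {y} = _
      rw [hs h hh, PMF.toMeasure_apply_singleton _ _ (measurableSet_singleton y)]
      rfl
  rw [measureReal_def, e2, ENNReal.toReal_mul, ENNReal.toReal_ofReal (hP.1 s y), mul_comm]
  rfl

/-- Taboo probabilities: the chain stays in `F` at the times `1, …, n`. -/
lemma chainLaw_taboo (F : Finset S) (x y : S) (n : ℕ) :
    (chainLaw P hP x).real
      {ω | (∀ k, 0 < k → k < n + 1 → ω k ∉ {s | s ∉ F}) ∧ ω (n + 1) = y} =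
      (P * restrictRows P F ^ n) x y := by
  induction n generalizing y with
  | zero =>
    have h := chainLaw_succ P hP x x y 0 (G := {h | h ⟨0, Finset.mem_Iic.2 le_rfl⟩ = x})
      (Set.Finite.measurableSet (Set.toFinite _)) (fun h hh => hh)
    have h0 : (chainLaw P hP x).real {ω | Preorder.frestrictLe (π := fun _ => S) 0 ω ∈
        {h : Finset.Iic 0 → S | h ⟨0, Finset.mem_Iic.2 le_rfl⟩ = x}} = 1 := by
      change (chainLaw P hP x).real {ω | ω 0 = x} = 1
      rw [measureReal_def, chainLaw_zero]; rfl
    rw [h0, one_mul] at h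
    -- With n = 0 the taboo condition is vacuous; only the almost sure event ω 0 = x has to be
    -- removed.
    have hae : ∀ᵐ ω ∂(chainLaw P hP x), ω 0 = x := by
      have hm : MeasurableSet ((fun ω : ℕ → S => ω 0) ⁻¹' {x}) :=
        measurable_pi_apply 0 (measurableSet_singleton x)
      exact (mem_ae_iff_prob_eq_one hm).2 (chainLaw_zero P hP x)
    rw [pow_zero, mul_one, ← h]
    refine measureReal_congr ?_
    filter_upwards [hae] with ω hω
    refine propext ⟨fun h => ⟨hω, h.2⟩, fun h => ⟨fun k h1 h2 => ?_, h.2⟩⟩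
    omega
  | succ n ih =>
    -- Split by the state s at the last taboo time n + 1, so that the Markov property applies to
    -- each piece.
    have hdecomp : {ω : ℕ → S | (∀ k, 0 < k → k < n + 1 + 1 → ω k ∉ {s | s ∉ F}) ∧
        ω (n + 1 + 1) = y} = ⋃ s ∈ F, {ω : ℕ → S | Preorder.frestrictLe (π := fun _ => S) (n + 1) ω ∈
          {h : Finset.Iic (n + 1) → S |
            (∀ k : Finset.Iic (n + 1), 0 < (k : ℕ) → (k : ℕ) < n + 1 → h k ∉ {s | s ∉ F}) ∧
            h ⟨n + 1, Finset.mem_Iic.2 le_rfl⟩ = s} ∧ ω (n + 1 + 1) = y} := by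
      ext ω
      simp only [Set.mem_ofPred_eq, not_not, Set.mem_iUnion, exists_prop]
      constructor
      · rintro ⟨h, hy⟩
        exact ⟨ω (n + 1), h _ (by omega) (by omega),
          ⟨fun k h1 h2 => h k h1 (by omega), rfl⟩, hy⟩
      · rintro ⟨s, hs, ⟨h1, h2⟩, hy⟩
        refine ⟨fun k hk hk' => ?_, hy⟩
        rcases Nat.lt_succ_iff_lt_or_eq.1 hk' with h | h
        · exact h1 ⟨k, Finset.mem_Iic.2 (by omega)⟩ hk h
        · subst h
          have h2' : ω (n + 1) = s := h2
          rwa [h2']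
    have hmG : ∀ s, MeasurableSet {h : Finset.Iic (n + 1) → S |
            (∀ k : Finset.Iic (n + 1), 0 < (k : ℕ) → (k : ℕ) < n + 1 → h k ∉ {s | s ∉ F}) ∧
            h ⟨n + 1, Finset.mem_Iic.2 le_rfl⟩ = s} := fun s => Set.Finite.measurableSet (Set.toFinite _)
    rw [hdecomp, measureReal_biUnion_finset]
    · have : ∀ s ∈ F, (chainLaw P hP x).real
          {ω : ℕ → S | Preorder.frestrictLe (π := fun _ => S) (n + 1) ω ∈
          {h : Finset.Iic (n + 1) → S |
            (∀ k : Finset.Iic (n + 1), 0 < (k : ℕ) → (k : ℕ) < n + 1 → h k ∉ {s | s ∉ F}) ∧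
            h ⟨n + 1, Finset.mem_Iic.2 le_rfl⟩ = s} ∧ ω (n + 1 + 1) = y} =
          (P * restrictRows P F ^ n) x s * P s y := by
        intro s _
        rw [chainLaw_succ P hP x s y (n + 1) (hmG s) (fun h hh => hh.2), ← ih s]
        congr 2
        ext ω
        exact ⟨fun h => ⟨fun k h1 h2 => h.1 ⟨k, Finset.mem_Iic.2 (by omega)⟩ h1 h2, h.2⟩,
          fun h => ⟨fun k h1 h2 => h.1 k h1 h2, h.2⟩⟩
      rw [Finset.sum_congr rfl this, pow_succ, ← mul_assoc, Matrix.mul_apply,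
        ← Finset.sum_subset (Finset.subset_univ F)]
      · refine Finset.sum_congr rfl fun s hs => ?_
        simp [restrictRows, hs]
      · intro s _ hs
        simp [restrictRows, hs]
    · intro s _ t _ hst
      refine Set.disjoint_left.2 fun ω h1 h2 => hst ?_
      exact h1.1.2.symm.trans h2.1.2
    · intro s _
      exact (measurable_pi_lambda _ (fun _ => measurable_pi_apply _) (hmG s)).inter
        (measurable_pi_apply (n + 1 + 1) (measurableSet_singleton y) :
          MeasurableSet ((fun ω : ℕ → S => ω (n + 1 + 1)) ⁻¹' {y}))

end ChainLaw

lemma hitTimePos_eq_coe_iff {S : Type*} (A : Set S) (ω : ℕ → S) (n : ℕ) :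
    hitTimePos A ω = n ↔ 0 < n ∧ ω n ∈ A ∧ ∀ k, 0 < k → k < n → ω k ∉ A := by
  unfold hitTimePos
  constructor
  · intro h
    have hne : Nonempty {n : ℕ // 0 < n ∧ ω n ∈ A} := by
      by_contra hc
      rw [not_nonempty_iff] at hc
      rw [iInf_of_empty] at h
      exact ENat.natCast_ne_top n h.symm
    obtain ⟨m, hm⟩ := ciInf_mem (fun n : {n : ℕ // 0 < n ∧ ω n ∈ A} => ((n : ℕ) : ℕ∞))
    rw [h] at hm
    have hm' : (m : ℕ) = n := Nat.cast_injective (R := ℕ∞) hm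
    refine ⟨hm' ▸ m.2.1, hm' ▸ m.2.2, fun k hk hkn hkA => ?_⟩
    have := iInf_le (fun n : {n : ℕ // 0 < n ∧ ω n ∈ A} => ((n : ℕ) : ℕ∞)) ⟨k, hk, hkA⟩
    rw [h] at this
    have : n ≤ k := by exact_mod_cast this
    omega
  · rintro ⟨h0, hA, hk⟩
    refine le_antisymm (iInf_le (fun n : {n : ℕ // 0 < n ∧ ω n ∈ A} => ((n : ℕ) : ℕ∞)) ⟨n, h0, hA⟩) ?_
    refine le_iInf fun m => ?_
    by_contra hc
    have : (m : ℕ) < n := by exact_mod_cast not_le.1 hc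
    exact hk m m.2.1 this m.2.2

/-- The hitting probabilities as sums of taboo probabilities. -/
theorem hasSum_hitProb {S : Type*} [Fintype S] [DecidableEq S] (P : Matrix S S ℝ)
    (hP : P ∈ Matrix.rowStochastic ℝ S) (F : Finset S) (x y : S) (hy : y ∉ F) :
    HasSum (fun n => (P * restrictRows P F ^ n) x y) (hitProb P hP x {s | s ∉ F} y) := by
  let : MeasurableSpace S := ⊤
  -- As y ∉ F, being at y at time n + 1 after staying in F at times 1, …, n means that the hitting
  -- time is n + 1. Index n stands for time n + 1 because the hitting time is positive.
  have hset : {ω : ℕ → S | ∃ n : ℕ, hitTimePos {s | s ∉ F} ω = n ∧ ω n = y} =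
      ⋃ n : ℕ, {ω : ℕ → S | (∀ k, 0 < k → k < n + 1 → ω k ∉ {s | s ∉ F}) ∧ ω (n + 1) = y} := by
    ext ω
    simp only [hitTimePos_eq_coe_iff, Set.mem_iUnion, Set.mem_ofPred_eq]
    constructor
    · rintro ⟨n, ⟨h0, _, hk⟩, hn⟩
      obtain ⟨m, rfl⟩ := Nat.exists_eq_succ_of_ne_zero h0.ne'
      exact ⟨m, hk, hn⟩
    · rintro ⟨n, hk, hn⟩
      exact ⟨n + 1, ⟨n.succ_pos, hn ▸ hy, hk⟩, hn⟩
  have hdisj : Pairwise (Function.onFun Disjoint fun n : ℕ =>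
      {ω : ℕ → S | (∀ k, 0 < k → k < n + 1 → ω k ∉ {s | s ∉ F}) ∧ ω (n + 1) = y}) := by
    intro m n hmn
    refine Set.disjoint_left.2 fun ω h1 h2 => ?_
    rcases lt_or_gt_of_ne hmn with h | h
    · exact h2.1 (m + 1) m.succ_pos (by omega) (by rw [h1.2]; exact hy)
    · exact h1.1 (n + 1) n.succ_pos (by omega) (by rw [h2.2]; exact hy)
  have hU := measure_iUnion (μ := chainLaw P hP x) hdisj
    (fun n => measurableSet_taboo {s | s ∉ F} (n + 1) y)
  have h := ENNReal.hasSum_toReal (hU ▸ measure_ne_top (chainLaw P hP x) _)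
  rw [← ENNReal.tsum_toReal_eq (fun n => measure_ne_top _ _), ← hU, ← hset] at h
  have ht := chainLaw_taboo P hP F x y
  simp only [measureReal_def] at ht
  simp only [ht] at h
  exact h

/-! ### Balance equations and elimination of states -/

/-- The measure `μ` on `T` satisfies the balance equations of the jump rates `q`. -/
def IsBalanced {V : Type*} (T : Finset V) (q : V → V → ℝ) (μ : V → ℝ) : Prop :=
  ∀ y ∈ T, ∑ z ∈ T, μ z * q z y = μ y * ∑ z ∈ T, q y z

/-- The jump rates `q` on `T` after elimination of the state `b`. -/
noncomputable def eliminate {V : Type*} (T : Finset V) (b : V) (q : V → V → ℝ) (y z : V) : ℝ :=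
  q y z + q y b * q b z / ∑ w ∈ T, q b w

section Elimination

variable {V : Type*} {T : Finset V} {b : V} {q q' : V → V → ℝ} {μ : V → ℝ}

lemma eliminate_nonneg (hq : ∀ y z, 0 ≤ q y z) (y z : V) : 0 ≤ eliminate T b q y z :=
  add_nonneg (hq y z) (div_nonneg (mul_nonneg (hq _ _) (hq _ _))
    (Finset.sum_nonneg fun _ _ => hq _ _))

lemma le_eliminate (hq : ∀ y z, 0 ≤ q y z) (y z : V) : q y z ≤ eliminate T b q y z :=
  le_add_of_nonneg_right (div_nonneg (mul_nonneg (hq _ _) (hq _ _))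
    (Finset.sum_nonneg fun _ _ => hq _ _))

/-- The detour through b costs C ^ 3: one factor C for each of its two jumps and one for the total
rate out of b. The direct rate costs C, and its hypothesis already allows a detour on the right. -/
lemma eliminate_le {C : ℝ} (hC : 1 ≤ C) (hq : ∀ y z, 0 ≤ q y z) (hq' : ∀ y z, 0 ≤ q' y z)
    (hrow : ∀ z, q b z ≤ C * q' b z) (hrow' : ∀ z, q' b z ≤ C * q b z)
    (hcol : ∀ y, q y b ≤ C * q' y b) (h : ∀ y z, q y z ≤ C * eliminate T b q' y z) (y z : V) :
    eliminate T b q y z ≤ (C + C ^ 3) * eliminate T b q' y z := by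
  have hC0 : 0 ≤ C := by linarith
  have key : q y b * q b z / ∑ w ∈ T, q b w ≤
      C ^ 3 * (q' y b * q' b z / ∑ w ∈ T, q' b w) := by
    have hS : 0 ≤ ∑ w ∈ T, q b w := Finset.sum_nonneg fun _ _ => hq _ _
    have hS' : 0 ≤ ∑ w ∈ T, q' b w := Finset.sum_nonneg fun _ _ => hq' _ _
    have hle : ∑ w ∈ T, q b w ≤ C * ∑ w ∈ T, q' b w := by
      rw [Finset.mul_sum]; exact Finset.sum_le_sum fun w _ => hrow w
    have hle' : ∑ w ∈ T, q' b w ≤ C * ∑ w ∈ T, q b w := by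
      rw [Finset.mul_sum]; exact Finset.sum_le_sum fun w _ => hrow' w
    rcases hS.eq_or_lt with h0 | h0
    · rw [← h0, div_zero]
      exact mul_nonneg (pow_nonneg hC0 3)
        (div_nonneg (mul_nonneg (hq' _ _) (hq' _ _)) hS')
    · have h0' : 0 < ∑ w ∈ T, q' b w := by
        by_contra hc
        have : ∑ w ∈ T, q' b w = 0 := le_antisymm (not_lt.1 hc) hS'
        rw [this, mul_zero] at hle
        linarith
      rw [← mul_div_assoc, div_le_div_iff₀ h0 h0']
      calc q y b * q b z * ∑ w ∈ T, q' b w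
          ≤ (C * q' y b) * (C * q' b z) * (C * ∑ w ∈ T, q b w) := by
            have := hq' y b
            have := hq' b z
            have := hq b z
            have := hq y b
            gcongr
            · exact hcol y
            · exact hrow z
        _ = _ := by ring
  have hel := eliminate_nonneg (T := T) (b := b) hq' y z
  have h2 : q' y b * q' b z / ∑ w ∈ T, q' b w ≤ eliminate T b q' y z :=
    le_add_of_nonneg_left (hq' y z)
  calc eliminate T b q y z ≤ C * eliminate T b q' y z + C ^ 3 * eliminate T b q' y z :=
        add_le_add (h y z) (key.trans (by gcongr))
    _ = _ := by ring

variable [DecidableEq V]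

/-- The balance at b expresses its outflow through the inflow from T; substituting this in the
equations on T turns visits to b into direct jumps. -/
lemma isBalanced_insert_iff (hb : b ∉ T) (hq : ∀ y z, 0 ≤ q y z) (hμ : ∀ y, 0 ≤ μ y) :
    IsBalanced (insert b T) q μ ↔
      μ b * ∑ w ∈ T, q b w = ∑ z ∈ T, μ z * q z b ∧ IsBalanced T (eliminate T b q) μ := by
  have hB : (∑ z ∈ insert b T, μ z * q z b = μ b * ∑ z ∈ insert b T, q b z) ↔
      μ b * ∑ w ∈ T, q b w = ∑ z ∈ T, μ z * q z b := by
    rw [Finset.sum_insert hb, Finset.sum_insert hb]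
    constructor <;> intro h <;> linarith
  have hY : μ b * ∑ w ∈ T, q b w = ∑ z ∈ T, μ z * q z b → ∀ y ∈ T,
      ((∑ z ∈ insert b T, μ z * q z y = μ y * ∑ z ∈ insert b T, q y z) ↔
        ∑ z ∈ T, μ z * eliminate T b q z y = μ y * ∑ z ∈ T, eliminate T b q y z) := by
    intro hbal y hy
    have e1 : ∑ z ∈ T, μ z * eliminate T b q z y =
        ∑ z ∈ T, μ z * q z y + (∑ z ∈ T, μ z * q z b) * (q b y / ∑ w ∈ T, q b w) := by
      rw [Finset.sum_mul, ← Finset.sum_add_distrib]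
      exact Finset.sum_congr rfl fun z _ => by unfold eliminate; ring
    have e2 : ∑ z ∈ T, eliminate T b q y z =
        ∑ z ∈ T, q y z + q y b * ((∑ w ∈ T, q b w) / ∑ w ∈ T, q b w) := by
      unfold eliminate
      rw [Finset.sum_add_distrib, ← Finset.sum_div, ← Finset.mul_sum, mul_div_assoc]
    rw [e1, e2, Finset.sum_insert hb, Finset.sum_insert hb, ← hbal]
    -- If b has no rate into T, its balance and nonnegativity make every flow from T into b vanish,
    -- so the division by zero is harmless.
    by_cases h0 : ∑ w ∈ T, q b w = 0
    · have hby : q b y = 0 := (Finset.sum_eq_zero_iff_of_nonneg fun _ _ => hq _ _).1 h0 y hy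
      have hyb : μ y * q y b = 0 := by
        rw [h0, mul_zero] at hbal
        exact (Finset.sum_eq_zero_iff_of_nonneg fun z _ => mul_nonneg (hμ z) (hq z b)).1
          hbal.symm y hy
      rw [hby, h0, div_zero, mul_add, hyb]
      simp
    · rw [div_self h0]
      have : μ b * (∑ w ∈ T, q b w) * (q b y / ∑ w ∈ T, q b w) = μ b * q b y := by
        field_simp
      rw [this]
      constructor <;> intro h <;> linarith
  constructor
  · intro h
    have h1 := hB.1 (h b (Finset.mem_insert_self b T))
    exact ⟨h1, fun y hy => (hY h1 y hy).1 (h y (Finset.mem_insert_of_mem hy))⟩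
  · rintro ⟨h1, h2⟩ y hy
    rcases Finset.mem_insert.1 hy with rfl | hy
    · exact hB.2 h1
    · exact (hY h1 y hy).2 (h2 y hy)

/-- If b cannot jump into T, the point mass at b is balanced. Otherwise a balanced measure of the
eliminated rates is extended by the mass at b that its balance equation prescribes. -/
theorem exists_isBalanced (hT : T.Nonempty) (hq : ∀ y z, 0 ≤ q y z) :
    ∃ μ : V → ℝ, (∀ y, 0 ≤ μ y) ∧ 0 < ∑ y ∈ T, μ y ∧ IsBalanced T q μ := by
  induction T using Finset.induction_on generalizing q with
  | empty => exact absurd hT Finset.not_nonempty_empty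
  | insert b T hb ih =>
    by_cases h0 : ∑ w ∈ T, q b w = 0
    · have hT0 : ∀ y ∈ T, (Pi.single b 1 : V → ℝ) y = 0 := fun y hy =>
        Pi.single_eq_of_ne (ne_of_mem_of_not_mem hy hb) _
      have hnn : ∀ y, 0 ≤ (Pi.single b 1 : V → ℝ) y := fun y => by
        by_cases h : y = b
        · subst h; simp
        · simp [h]
      refine ⟨Pi.single b 1, hnn, ?_, (isBalanced_insert_iff hb hq hnn).2 ⟨?_, fun y hy => ?_⟩⟩
      · rw [Finset.sum_insert hb, Finset.sum_eq_zero hT0]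
        simp
      · rw [h0, mul_zero, Finset.sum_eq_zero fun z hz => by rw [hT0 z hz, zero_mul]]
      · rw [hT0 y hy, zero_mul, Finset.sum_eq_zero fun z hz => by rw [hT0 z hz, zero_mul]]
    · have hne : T.Nonempty := by
        rw [Finset.nonempty_iff_ne_empty]
        rintro rfl
        simp at h0
      obtain ⟨μ, hμ, hpos, hbal⟩ := ih hne (eliminate_nonneg (T := T) (b := b) hq)
      have hS : 0 ≤ ∑ w ∈ T, q b w := Finset.sum_nonneg fun _ _ => hq _ _
      set m := (∑ z ∈ T, μ z * q z b) / ∑ w ∈ T, q b w with hm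
      have hm0 : 0 ≤ m := div_nonneg (Finset.sum_nonneg fun z _ => mul_nonneg (hμ z) (hq _ _)) hS
      have hu : ∀ y ∈ T, Function.update μ b m y = μ y := fun y hy =>
        Function.update_of_ne (ne_of_mem_of_not_mem hy hb) _ _
      have hnn : ∀ y, 0 ≤ Function.update μ b m y := fun y => by
        by_cases h : y = b
        · subst h; simpa using hm0
        · simpa [h] using hμ y
      refine ⟨Function.update μ b m, hnn, ?_, (isBalanced_insert_iff hb hq hnn).2 ⟨?_, ?_⟩⟩
      · rw [Finset.sum_insert hb, Finset.sum_congr rfl hu, Function.update_self]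
        linarith
      · rw [Function.update_self, hm, div_mul_cancel₀ _ h0]
        exact Finset.sum_congr rfl fun z hz => by rw [hu z hz]
      · intro y hy
        rw [hu y hy, ← hbal y hy]
        exact Finset.sum_congr rfl fun z hz => by rw [hu z hz]

/-- On `T`, balanced measures of comparable jump rates are comparable. -/
def BalancedComparison (T : Finset V) : Prop :=
  ∀ C : ℝ, 1 ≤ C → ∃ D : ℝ, 1 ≤ D ∧ ∀ (q q' : V → V → ℝ) (μ : V → ℝ),
    (∀ y z, 0 ≤ q y z) → (∀ y z, 0 ≤ q' y z) → (∀ y z, q y z ≤ C * q' y z) →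
    (∀ y z, q' y z ≤ C * q y z) → (∀ y, 0 ≤ μ y) → IsBalanced T q μ →
    ∃ ν : V → ℝ, (∀ y, 0 ≤ ν y) ∧ IsBalanced T q' ν ∧ ∀ y ∈ T, ν y ≤ D * μ y ∧ μ y ≤ D * ν y

/-- The comparison of balanced measures, when the jump rates are comparable up to
jumps via the state `b`. -/
theorem BalancedComparison.insert_aux (hb : b ∉ T) (hT : BalancedComparison T) (C : ℝ)
    (hC : 1 ≤ C) : ∃ D : ℝ, 1 ≤ D ∧ ∀ (q q' : V → V → ℝ) (μ : V → ℝ),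
      (∀ y z, 0 ≤ q y z) → (∀ y z, 0 ≤ q' y z) →
      (∀ z, q b z ≤ C * q' b z) → (∀ z, q' b z ≤ C * q b z) →
      (∀ y, q y b ≤ C * q' y b) → (∀ y, q' y b ≤ C * q y b) →
      (∀ y z, q y z ≤ C * eliminate T b q' y z) → (∀ y z, q' y z ≤ C * eliminate T b q y z) →
      (∀ y, 0 ≤ μ y) → IsBalanced (insert b T) q μ →
      ∃ ν : V → ℝ, (∀ y, 0 ≤ ν y) ∧ IsBalanced (insert b T) q' ν ∧
        ∀ y ∈ insert b T, ν y ≤ D * μ y ∧ μ y ≤ D * ν y := by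
  have hC0 : 0 ≤ C := by linarith
  obtain ⟨D, hD, hcomp⟩ := hT (C + C ^ 3) (by nlinarith [pow_nonneg hC0 3])
  have hD0 : 0 ≤ D := by linarith
  have hDC : D ≤ D * C ^ 2 := le_mul_of_one_le_right hD0 (one_le_pow₀ hC)
  -- The mass at b is inflow divided by outflow rate: D * C for the inflow and one more C for the
  -- rate.
  refine ⟨D * C ^ 2, hD.trans hDC, ?_⟩
  intro q q' μ hq hq' hr hr' hc hc' h h' hμ hbal
  obtain ⟨hbb, hbT⟩ := (isBalanced_insert_iff hb hq hμ).1 hbal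
  obtain ⟨ν, hν, hνbal, hνμ⟩ := hcomp _ _ μ (eliminate_nonneg hq) (eliminate_nonneg hq')
    (eliminate_le hC hq hq' hr hr' hc h) (eliminate_le hC hq' hq hr' hr hc' h') hμ hbT
  have hS : 0 ≤ ∑ w ∈ T, q b w := Finset.sum_nonneg fun _ _ => hq _ _
  have hS' : 0 ≤ ∑ w ∈ T, q' b w := Finset.sum_nonneg fun _ _ => hq' _ _
  have hle : ∑ w ∈ T, q b w ≤ C * ∑ w ∈ T, q' b w := by
    rw [Finset.mul_sum]; exact Finset.sum_le_sum fun w _ => hr w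
  have hle' : ∑ w ∈ T, q' b w ≤ C * ∑ w ∈ T, q b w := by
    rw [Finset.mul_sum]; exact Finset.sum_le_sum fun w _ => hr' w
  have hF : ∑ z ∈ T, ν z * q' z b ≤ D * C * ∑ z ∈ T, μ z * q z b := by
    rw [Finset.mul_sum]
    refine Finset.sum_le_sum fun z hz => ?_
    calc ν z * q' z b ≤ (D * μ z) * (C * q z b) :=
          mul_le_mul (hνμ z hz).1 (hc' z) (hq' _ _) (mul_nonneg hD0 (hμ z))
      _ = _ := by ring
  have hF' : ∑ z ∈ T, μ z * q z b ≤ D * C * ∑ z ∈ T, ν z * q' z b := by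
    rw [Finset.mul_sum]
    refine Finset.sum_le_sum fun z hz => ?_
    calc μ z * q z b ≤ (D * ν z) * (C * q' z b) :=
          mul_le_mul (hνμ z hz).2 (hc z) (hq _ _) (mul_nonneg hD0 (hν z))
      _ = _ := by ring
  have hFν : 0 ≤ ∑ z ∈ T, ν z * q' z b := Finset.sum_nonneg fun z _ => mul_nonneg (hν z) (hq' _ _)
  obtain ⟨m, hm0, hmb, hm1, hm2⟩ : ∃ m : ℝ, 0 ≤ m ∧ m * ∑ w ∈ T, q' b w = ∑ z ∈ T, ν z * q' z b ∧
      m ≤ D * C ^ 2 * μ b ∧ μ b ≤ D * C ^ 2 * m := by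
    -- If b has no rate into T for q', it has none for q, the inflow vanishes for both, and any mass
    -- at b is balanced; keep μ b.
    rcases hS'.eq_or_lt with h0 | h0
    · have hS0 : ∑ w ∈ T, q b w = 0 := by
        rw [← h0, mul_zero] at hle
        exact le_antisymm hle hS
      rw [hS0, mul_zero] at hbb
      rw [← hbb, mul_zero] at hF
      have := le_mul_of_one_le_left (hμ b) (hD.trans hDC)
      exact ⟨μ b, hμ b, by rw [← h0, mul_zero]; exact le_antisymm hFν hF, this, this⟩
    · have h0S : 0 < ∑ w ∈ T, q b w := by
        by_contra hcn
        rw [le_antisymm (not_lt.1 hcn) hS, mul_zero] at hle'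
        linarith
      refine ⟨(∑ z ∈ T, ν z * q' z b) / ∑ w ∈ T, q' b w, div_nonneg hFν hS',
        div_mul_cancel₀ _ h0.ne', ?_, ?_⟩
      · rw [div_le_iff₀ h0]
        calc _ ≤ D * C * (μ b * ∑ w ∈ T, q b w) := by rw [hbb]; exact hF
          _ ≤ D * C * (μ b * (C * ∑ w ∈ T, q' b w)) := by
            have := hμ b
            gcongr
          _ = _ := by ring
      · rw [← mul_div_assoc, le_div_iff₀ h0]
        calc μ b * ∑ w ∈ T, q' b w ≤ μ b * (C * ∑ w ∈ T, q b w) := by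
              have := hμ b
              gcongr
          _ = C * ∑ z ∈ T, μ z * q z b := by rw [← hbb]; ring
          _ ≤ C * (D * C * ∑ z ∈ T, ν z * q' z b) := by gcongr
          _ = _ := by ring
  have hu : ∀ y ∈ T, Function.update ν b m y = ν y := fun y hy =>
    Function.update_of_ne (ne_of_mem_of_not_mem hy hb) _ _
  have hnn : ∀ y, 0 ≤ Function.update ν b m y := fun y => by
    by_cases h : y = b
    · subst h; simpa using hm0
    · simpa [h] using hν y
  refine ⟨Function.update ν b m, hnn, (isBalanced_insert_iff hb hq' hnn).2 ⟨?_, ?_⟩, ?_⟩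
  · rw [Function.update_self, hmb]
    exact Finset.sum_congr rfl fun z hz => by rw [hu z hz]
  · intro y hy
    rw [hu y hy, ← hνbal y hy]
    exact Finset.sum_congr rfl fun z hz => by rw [hu z hz]
  · intro y hy
    rcases Finset.mem_insert.1 hy with rfl | hy
    · rw [Function.update_self]
      exact ⟨hm1, hm2⟩
    · rw [hu y hy]
      exact ⟨(hνμ y hy).1.trans (by have := hμ y; gcongr),
        (hνμ y hy).2.trans (by have := hν y; gcongr)⟩

/-- Elimination only increases rates, so comparable rates are in particular comparable up to detours
via b. -/
theorem balancedComparison (T : Finset V) : BalancedComparison T := by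
  induction T using Finset.induction_on with
  | empty => exact fun C _ => ⟨1, le_rfl, fun q q' μ _ _ _ _ hμ _ =>
      ⟨μ, hμ, fun y hy => absurd hy (Finset.notMem_empty y),
        fun y hy => absurd hy (Finset.notMem_empty y)⟩⟩
  | insert b T hb ih =>
    intro C hC
    have hC0 : 0 ≤ C := by linarith
    obtain ⟨D, hD, h⟩ := ih.insert_aux hb C hC
    exact ⟨D, hD, fun q q' μ hq hq' hqq hqq' hμ hbal => h q q' μ hq hq' (hqq b) (hqq' b)
      (fun y => hqq y b) (fun y => hqq' y b)
      (fun y z => (hqq y z).trans (by gcongr; exact le_eliminate hq' y z))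
      (fun y z => (hqq' y z).trans (by gcongr; exact le_eliminate hq y z)) hμ hbal⟩

end Elimination

/-! ### Stationary distributions as balanced measures -/

lemma normalize_mem_stdSimplex {V : Type*} [Fintype V] {Q : Matrix V V ℝ} {μ : V → ℝ}
    (hμ : ∀ y, 0 ≤ μ y) (hpos : 0 < ∑ y, μ y)
    (hst : Matrix.vecMul μ Q = μ) :
    (fun y => μ y / ∑ z, μ z) ∈ stdSimplex ℝ V ∧
      Matrix.vecMul (fun y => μ y / ∑ z, μ z) Q = fun y => μ y / ∑ z, μ z := by
  refine ⟨⟨fun y => div_nonneg (hμ y) hpos.le, ?_⟩, ?_⟩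
  · rw [← Finset.sum_div, div_self hpos.ne']
  · have : (fun y => μ y / ∑ z, μ z) = (∑ z, μ z)⁻¹ • μ := by
      ext y; simp [div_eq_inv_mul]
    rw [this, Matrix.smul_vecMul, hst]

section Stochastic

variable {V : Type*} [Fintype V] [DecidableEq V] {Q : Matrix V V ℝ}

lemma isBalanced_univ_iff (hQ : Q ∈ Matrix.rowStochastic ℝ V) (μ : V → ℝ) :
    IsBalanced Finset.univ Q μ ↔ Matrix.vecMul μ Q = μ := by
  constructor
  · intro h
    ext y
    have := h y (Finset.mem_univ y)
    rw [Matrix.sum_row_of_mem_rowStochastic hQ, mul_one] at this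
    exact this
  · intro h y _
    rw [Matrix.sum_row_of_mem_rowStochastic hQ, mul_one]
    exact congrFun h y

theorem exists_stationary [Nonempty V] (hQ : Q ∈ Matrix.rowStochastic ℝ V) :
    ∃ μ ∈ stdSimplex ℝ V, Matrix.vecMul μ Q = μ := by
  obtain ⟨μ, hμ, hpos, hbal⟩ := exists_isBalanced (T := Finset.univ) (q := Q)
    Finset.univ_nonempty hQ.1
  obtain ⟨h1, h2⟩ := normalize_mem_stdSimplex hμ hpos ((isBalanced_univ_iff hQ μ).1 hbal)
  exact ⟨_, h1, h2⟩

end Stochastic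

/-! ### The trace of a chain -/

/-- The matrix whose entry at `(s, y)` is the expected number of visits of `y` at the times
`1, …, τ`, where `τ` is the first positive time outside `F`. Outside `F` this is the trace of the
chain of matrix `P`. -/
noncomputable def traceMatrix {S : Type*} [Fintype S] [DecidableEq S] (P : Matrix S S ℝ)
    (F : Finset S) : Matrix S S ℝ :=
  Matrix.of fun s y => ∑' n, (P * restrictRows P F ^ n) s y

/-- The first-step and last-step equations of the trace matrix. -/
structure IsTrace {S : Type*} [Fintype S] (P W : Matrix S S ℝ) (F : Finset S) : Prop where
  nonneg : ∀ s t, 0 ≤ P s t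
  nonneg_trace : ∀ s t, 0 ≤ W s t
  first_step : ∀ s z, W s z = P s z + ∑ t ∈ F, P s t * W t z
  last_step : ∀ s z, W s z = P s z + ∑ t ∈ F, W s t * P t z

section Trace

variable {S : Type*} [Fintype S] [DecidableEq S] {P W : Matrix S S ℝ} {F : Finset S}

lemma taboo_nonneg (hP : ∀ s t, 0 ≤ P s t) (n : ℕ) (s y : S) :
    0 ≤ (P * restrictRows P F ^ n) s y := by
  induction n generalizing y with
  | zero => simpa using hP s y
  | succ n ih =>
    rw [pow_succ, ← mul_assoc, Matrix.mul_apply]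
    refine Finset.sum_nonneg fun t _ => mul_nonneg (ih t) ?_
    by_cases h : t ∈ F
    · simpa [restrictRows, h] using hP t y
    · simp [restrictRows, h]

lemma taboo_succ (n : ℕ) (s y : S) :
    (P * restrictRows P F ^ (n + 1)) s y =
      ∑ t ∈ F, (P * restrictRows P F ^ n) s t * P t y := by
  rw [pow_succ, ← mul_assoc, Matrix.mul_apply, ← Finset.sum_subset (Finset.subset_univ F)]
  · exact Finset.sum_congr rfl fun t ht => by simp [restrictRows, ht]
  · intro t _ ht
    simp [restrictRows, ht]

lemma taboo_succ' (n : ℕ) (s y : S) :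
    (P * restrictRows P F ^ (n + 1)) s y =
      ∑ t ∈ F, P s t * (P * restrictRows P F ^ n) t y := by
  rw [pow_succ', Matrix.mul_apply, ← Finset.sum_subset (Finset.subset_univ F)]
  · refine Finset.sum_congr rfl fun t ht => ?_
    rw [Matrix.mul_apply, Matrix.mul_apply]
    simp [restrictRows, ht]
  · intro t _ ht
    rw [Matrix.mul_apply]
    simp [restrictRows, ht]

/-- Each visit to t is followed by a jump to u with probability P t u, so the expected visits to t
are at most those to u divided by P t u. -/
lemma summable_taboo_of_pos (hP : ∀ s t, 0 ≤ P s t) {s t u : S} (ht : t ∈ F) (htu : 0 < P t u)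
    (h : Summable fun n => (P * restrictRows P F ^ n) s u) :
    Summable fun n => (P * restrictRows P F ^ n) s t := by
  have h1 : Summable fun n => (P * restrictRows P F ^ (n + 1)) s u :=
    (summable_nat_add_iff (f := fun n => (P * restrictRows P F ^ n) s u) 1).2 h
  refine Summable.of_nonneg_of_le (fun n => taboo_nonneg hP n s t) (fun n => ?_)
    (h1.mul_right (P t u)⁻¹)
  rw [← div_eq_mul_inv, le_div_iff₀ htu, taboo_succ]
  exact Finset.single_le_sum (f := fun t => (P * restrictRows P F ^ n) s t * P t u)
    (fun v _ => mul_nonneg (taboo_nonneg hP n s v) (hP v u)) ht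

/-- If from every state in `F` there is a path of positive probability that leaves `F`, then the
trace matrix is well defined. -/
theorem isTrace_traceMatrix (hP : P ∈ Matrix.rowStochastic ℝ S)
    (hexit : ∀ t ∈ F, ∃ u ∉ F, Relation.ReflTransGen (fun s t => 0 < P s t) t u) :
    IsTrace P (traceMatrix P F) F := by
  have hsum : ∀ s t, Summable fun n => (P * restrictRows P F ^ n) s t := by
    intro s t
    by_cases ht : t ∈ F
    · obtain ⟨u, hu, hpath⟩ := hexit t ht
      clear ht
      -- Outside F the series sums to a hitting probability; finiteness then propagates backwards
      -- along the path.
      induction hpath using Relation.ReflTransGen.head_induction_on with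
      | refl => exact (hasSum_hitProb P hP F s u hu).summable
      | @head t v htv _ ih =>
        by_cases ht : t ∈ F
        · exact summable_taboo_of_pos hP.1 ht htv ih
        · exact (hasSum_hitProb P hP F s t ht).summable
    · exact (hasSum_hitProb P hP F s t ht).summable
  refine ⟨hP.1, fun s t => tsum_nonneg fun n => taboo_nonneg hP.1 n s t, fun s z => ?_,
    fun s z => ?_⟩
  · change ∑' n, _ = _
    rw [(hsum s z).tsum_eq_zero_add, pow_zero, mul_one]
    congr 1
    simp only [taboo_succ']
    rw [Summable.tsum_finsetSum fun t _ => (hsum t z).mul_left _]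
    exact Finset.sum_congr rfl fun t _ => tsum_mul_left
  · change ∑' n, _ = _
    rw [(hsum s z).tsum_eq_zero_add, pow_zero, mul_one]
    congr 1
    simp only [taboo_succ]
    rw [Summable.tsum_finsetSum fun t _ => (hsum s t).mul_right _]
    exact Finset.sum_congr rfl fun t _ => tsum_mul_right

lemma traceMatrix_eq_hitProb (hP : P ∈ Matrix.rowStochastic ℝ S) (s y : S) (hy : y ∉ F) :
    traceMatrix P F s y = hitProb P hP s {s | s ∉ F} y :=
  (hasSum_hitProb P hP F s y hy).tsum_eq

end Trace

/-! ### Uniform bounds inside an essential class -/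

section TraceBounds

variable {S : Type*} [Fintype S] {P W : Matrix S S ℝ} {F : Finset S}

lemma IsTrace.le (h : IsTrace P W F) (s z : S) : P s z ≤ W s z := by
  rw [h.first_step]
  exact le_add_of_nonneg_right
    (Finset.sum_nonneg fun t _ => mul_nonneg (h.nonneg _ _) (h.nonneg_trace _ _))

lemma IsTrace.mul_le (h : IsTrace P W F) (s z : S) {t : S} (ht : t ∈ F) :
    P s t * W t z ≤ W s z := by
  rw [h.first_step s z]
  exact le_add_of_nonneg_of_le (h.nonneg s z) (Finset.single_le_sum
    (f := fun t => P s t * W t z) (fun t _ => mul_nonneg (h.nonneg _ _) (h.nonneg_trace _ _)) ht)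

variable [DecidableEq S]

/-- Follow the path until it first meets x: each arc has probability at least c, and the sink
property keeps the path in E. The bound depends on the path alone, hence is uniform in P and W. -/
lemma IsTrace.exists_le_hit {R : S → S → Prop} {E : Finset S} {x t : S} {c : ℝ} (hc : 0 < c)
    (hsink : ∀ y ∈ E, ∀ z, R y z → z ∈ E) (ht : t ∈ E) (hpath : Relation.ReflTransGen R t x) :
    ∃ a : ℝ, 0 < a ∧ ∀ P W : Matrix S S ℝ, IsTrace P W (E.erase x) →
      (∀ s t, R s t → c ≤ P s t) → t ≠ x → a ≤ W t x := by
  induction hpath using Relation.ReflTransGen.head_induction_on with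
  | refl => exact ⟨1, one_pos, fun P W _ _ h => absurd rfl h⟩
  | @head t u htu _ ih =>
    have hu := hsink t ht u htu
    obtain ⟨a, ha, h⟩ := ih hu
    by_cases hux : u = x
    · subst hux
      exact ⟨c, hc, fun P W hW hR _ => (hR t u htu).trans (hW.le t u)⟩
    · refine ⟨c * a, mul_pos hc ha, fun P W hW hR _ => ?_⟩
      calc c * a ≤ P t u * W u x :=
            mul_le_mul (hR t u htu) (h P W hW hR hux) ha.le (hW.nonneg _ _)
        _ ≤ W t x := hW.mul_le t x (Finset.mem_erase.2 ⟨hux, hu⟩)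

/-- Exits via t are reached from s by following the path, unless the path meets x, where the
excursion stops; then the bound holds for the excursion started at x. For s = x the two alternatives
coincide. -/
lemma IsTrace.exists_mul_le {R : S → S → Prop} {E : Finset S} {x s t : S} {c : ℝ} (hc : 0 < c)
    (hsink : ∀ y ∈ E, ∀ z, R y z → z ∈ E) (hs : s ∈ E) (hpath : Relation.ReflTransGen R s t) :
    ∃ a : ℝ, 0 < a ∧ ∀ P W : Matrix S S ℝ, IsTrace P W (E.erase x) →
      (∀ s t, R s t → c ≤ P s t) → ∀ z, a * W t z ≤ W s z ∨ a * W t z ≤ W x z := by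
  induction hpath using Relation.ReflTransGen.head_induction_on with
  | refl => exact ⟨1, one_pos, fun P W _ _ z => Or.inl (one_mul _).le⟩
  | @head s u hsu _ ih =>
    have hu := hsink s hs u hsu
    obtain ⟨a, ha, h⟩ := ih hu
    by_cases hux : u = x
    · subst hux
      exact ⟨a, ha, fun P W hW hR z => Or.inr ((h P W hW hR z).elim id id)⟩
    · refine ⟨min a (c * a), lt_min ha (mul_pos hc ha), fun P W hW hR z => ?_⟩
      have hW0 := hW.nonneg_trace t z
      rcases h P W hW hR z with h | h
      · left
        calc min a (c * a) * W t z ≤ c * a * W t z := by gcongr; exact min_le_right _ _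
          _ = c * (a * W t z) := by ring
          _ ≤ P s u * W u z := mul_le_mul (hR s u hsu) h (by positivity) (hW.nonneg _ _)
          _ ≤ W s z := hW.mul_le s z (Finset.mem_erase.2 ⟨hux, hu⟩)
      · right
        exact (by gcongr; exact min_le_left _ _ : min a (c * a) * W t z ≤ a * W t z).trans h

/-- Along each arc, at least the fraction c of the mass is transported in one step of the stationary
chain. -/
lemma exists_mul_le_stationary {S : Type*} [Fintype S] {R : S → S → Prop} {s t : S} {c : ℝ}
    (hc : 0 < c) (hpath : Relation.ReflTransGen R s t) :
    ∃ a : ℝ, 0 < a ∧ ∀ (P : Matrix S S ℝ) (μ : S → ℝ), (∀ s t, 0 ≤ P s t) →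
      (∀ s t, R s t → c ≤ P s t) → (∀ s, 0 ≤ μ s) → Matrix.vecMul μ P = μ → a * μ s ≤ μ t := by
  induction hpath with
  | refl => exact ⟨1, one_pos, fun P μ _ _ _ _ => (one_mul _).le⟩
  | @tail t u _ htu ih =>
    obtain ⟨a, ha, h⟩ := ih
    refine ⟨c * a, mul_pos hc ha, fun P μ hP hR hμ hst => ?_⟩
    calc c * a * μ s = (a * μ s) * c := by ring
      _ ≤ μ t * P t u := mul_le_mul (h P μ hP hR hμ hst) (hR t u htu) hc.le (hμ t)
      _ ≤ ∑ v, μ v * P v u := Finset.single_le_sum (f := fun v => μ v * P v u)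
          (fun v _ => mul_nonneg (hμ v) (hP v u)) (Finset.mem_univ t)
      _ = μ u := congrFun hst u

end TraceBounds

lemma exists_pos_forall_of_antitone {ι : Type*} [Finite ι] {p : ι → ℝ → Prop}
    (hp : ∀ i a a', 0 < a' → a' ≤ a → p i a → p i a') (h : ∀ i, ∃ a, 0 < a ∧ p i a) :
    ∃ a, 0 < a ∧ ∀ i, p i a := by
  have hev : ∀ᶠ a in 𝓝[>] (0 : ℝ), ∀ i, p i a := by
    refine eventually_all.2 fun i => ?_
    obtain ⟨a, ha, hpa⟩ := h i
    filter_upwards [Ioc_mem_nhdsGT ha] with a' ha'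
    exact hp i a a' ha'.1 ha'.2 hpa
  obtain ⟨a, h1, h2⟩ := (hev.and self_mem_nhdsWithin).exists
  exact ⟨a, h2, h1⟩

/-! ### Trace versus collapse -/

section Collapse

variable {S : Type*} [Fintype S] [DecidableEq S] {P W : Matrix S S ℝ} {E : Finset S} {x : S}

/-- The representative in `S` of a state of the collapsed state space. -/
def representative (E : Finset S) (x : S) : Option {y : S // y ∉ E} → S
  | none => x
  | some y => y

/-- The collapse of `P` around `x`, expressed by the trace matrix `W`. -/
def collapseMatrix (P W : Matrix S S ℝ) (E : Finset S) (x : S) :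
    Matrix (Option {y : S // y ∉ E}) (Option {y : S // y ∉ E}) ℝ :=
  fun s t => match s, t with
    | none, t => W x (representative E x t)
    | some y, none => ∑ z ∈ E, P y z
    | some y, some z => P y z

/-- The trace of the chain outside `E.erase x`, on the collapsed state space. -/
def collapsedTrace (W : Matrix S S ℝ) (E : Finset S) (x : S) :
    Matrix (Option {y : S // y ∉ E}) (Option {y : S // y ∉ E}) ℝ :=
  fun s t => W (representative E x s) (representative E x t)

lemma sum_eq_sum_representative (hx : x ∈ E) (f : S → ℝ) :
    ∑ s, f s = ∑ v, f (representative E x v) + ∑ t ∈ E.erase x, f t := by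
  have h1 : ∑ y : {y : S // y ∉ E}, f y = ∑ y ∈ Eᶜ, f y :=
    (Finset.sum_subtype Eᶜ (fun y => Finset.mem_compl) f).symm
  rw [Fintype.sum_option, ← Finset.sum_add_sum_compl E, ← Finset.add_sum_erase E f hx]
  change _ = f x + ∑ y : {y : S // y ∉ E}, f y + _
  rw [h1]
  ring

/-- Summing the last-step equations over z gives each row of W the total 1 plus its part on E \ {x};
the remainder is 1. -/
lemma IsTrace.sum_representative (h : IsTrace P W (E.erase x)) (hP : P ∈ Matrix.rowStochastic ℝ S)
    (hx : x ∈ E) (s : S) : ∑ v, W s (representative E x v) = 1 := by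
  have h1 := sum_eq_sum_representative hx (W s)
  have h2 : ∑ z, W s z = 1 + ∑ t ∈ E.erase x, W s t := by
    rw [Finset.sum_congr rfl fun z _ => h.last_step s z, Finset.sum_add_distrib,
      Matrix.sum_row_of_mem_rowStochastic hP, Finset.sum_comm]
    congr 1
    refine Finset.sum_congr rfl fun t _ => ?_
    rw [← Finset.mul_sum, Matrix.sum_row_of_mem_rowStochastic hP, mul_one]
  linarith

lemma IsTrace.collapsedTrace_mem (h : IsTrace P W (E.erase x))
    (hP : P ∈ Matrix.rowStochastic ℝ S) (hx : x ∈ E) :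
    collapsedTrace W E x ∈ Matrix.rowStochastic ℝ (Option {y : S // y ∉ E}) :=
  Matrix.mem_rowStochastic_iff_sum.2
    ⟨fun _ _ => h.nonneg_trace _ _, fun _ => h.sum_representative hP hx _⟩

lemma IsTrace.collapseMatrix_mem (h : IsTrace P W (E.erase x))
    (hP : P ∈ Matrix.rowStochastic ℝ S) (hx : x ∈ E) :
    collapseMatrix P W E x ∈ Matrix.rowStochastic ℝ (Option {y : S // y ∉ E}) := by
  refine Matrix.mem_rowStochastic_iff_sum.2 ⟨?_, ?_⟩
  · rintro (_ | y) (_ | z)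
    · exact h.nonneg_trace _ _
    · exact h.nonneg_trace _ _
    · exact Finset.sum_nonneg fun t _ => h.nonneg _ _
    · exact h.nonneg _ _
  · rintro (_ | y)
    · exact h.sum_representative hP hx x
    · have h1 : ∑ z : {y : S // y ∉ E}, P y z = ∑ z ∈ Eᶜ, P y z :=
        (Finset.sum_subtype Eᶜ (fun y => Finset.mem_compl) (P y)).symm
      rw [Fintype.sum_option]
      change ∑ z ∈ E, P y z + ∑ z : {y : S // y ∉ E}, P y z = 1
      rw [h1, Finset.sum_add_sum_compl, Matrix.sum_row_of_mem_rowStochastic hP]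

/-- Integrate the first-step equation against μ over all of S: stationarity makes the terms from E \
{x} cancel. -/
lemma IsTrace.vecMul_collapsedTrace (h : IsTrace P W (E.erase x)) (hx : x ∈ E) {μ : S → ℝ}
    (hst : Matrix.vecMul μ P = μ) :
    Matrix.vecMul (μ ∘ representative E x) (collapsedTrace W E x) = μ ∘ representative E x := by
  have hst' : ∀ z, ∑ s, μ s * P s z = μ z := fun z => congrFun hst z
  ext v
  set z := representative E x v with hz
  change ∑ u, μ (representative E x u) * W (representative E x u) z = μ z
  have e1 := sum_eq_sum_representative hx (fun s => μ s * W s z)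
  have e2 : ∑ s, μ s * W s z = μ z + ∑ t ∈ E.erase x, μ t * W t z := by
    calc ∑ s, μ s * W s z
        = ∑ s, (μ s * P s z + ∑ t ∈ E.erase x, μ s * P s t * W t z) := by
          refine Finset.sum_congr rfl fun s _ => ?_
          rw [h.first_step s z, mul_add, Finset.mul_sum]
          simp only [mul_assoc]
      _ = μ z + ∑ t ∈ E.erase x, μ t * W t z := by
          rw [Finset.sum_add_distrib, hst', Finset.sum_comm]
          congr 1
          refine Finset.sum_congr rfl fun t _ => ?_
          rw [← Finset.sum_mul, hst']
  have e3 : ∑ s, μ s * W s z = ∑ u, μ (representative E x u) * W (representative E x u) z +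
      ∑ t ∈ E.erase x, μ t * W t z := e1
  linarith

/-- The extension gives each state the expected number of visits during an excursion started from ν;
the last-step equations make it invariant. -/
lemma IsTrace.exists_vecMul_eq (h : IsTrace P W (E.erase x)) (hx : x ∈ E)
    {ν : Option {y : S // y ∉ E} → ℝ} (hν : ∀ v, 0 ≤ ν v)
    (hst : Matrix.vecMul ν (collapsedTrace W E x) = ν) :
    ∃ μ : S → ℝ, (∀ s, 0 ≤ μ s) ∧ Matrix.vecMul μ P = μ ∧ μ ∘ representative E x = ν := by
  have hrep : ∀ v, ∑ u, ν u * W (representative E x u) (representative E x v) = ν v :=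
    fun v => congrFun hst v
  refine ⟨fun s => ∑ u, ν u * W (representative E x u) s,
    fun s => Finset.sum_nonneg fun u _ => mul_nonneg (hν u) (h.nonneg_trace _ _), ?_,
    funext hrep⟩
  ext z
  change ∑ s, (∑ u, ν u * W (representative E x u) s) * P s z = ∑ u, ν u * W (representative E x u) z
  rw [sum_eq_sum_representative hx]
  simp only [hrep]
  rw [Finset.sum_congr rfl fun t _ => Finset.sum_mul Finset.univ
      (fun u => ν u * W (representative E x u) t) (P t z), Finset.sum_comm,
    ← Finset.sum_add_distrib]
  refine Finset.sum_congr rfl fun u _ => ?_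
  rw [h.last_step _ z, mul_add, Finset.mul_sum]
  simp only [mul_assoc]

/-- Comparison of the balanced measures of the trace and of the collapse. -/
theorem exists_compare_collapse (hx : x ∈ E) {a : ℝ} (ha : 0 < a) (ha1 : a ≤ 1) :
    ∃ D : ℝ, 1 ≤ D ∧ ∀ P W : Matrix S S ℝ, P ∈ Matrix.rowStochastic ℝ S →
      IsTrace P W (E.erase x) → (∀ t ∈ E.erase x, a ≤ W t x) →
      (∀ t ∈ E.erase x, ∀ z, a * W t z ≤ W x z) →
      (∀ μ, (∀ v, 0 ≤ μ v) → Matrix.vecMul μ (collapsedTrace W E x) = μ →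
        ∃ ν, (∀ v, 0 ≤ ν v) ∧ Matrix.vecMul ν (collapseMatrix P W E x) = ν ∧
          ∀ v, ν v ≤ D * μ v ∧ μ v ≤ D * ν v) ∧
      (∀ ν, (∀ v, 0 ≤ ν v) → Matrix.vecMul ν (collapseMatrix P W E x) = ν →
        ∃ μ, (∀ v, 0 ≤ μ v) ∧ Matrix.vecMul μ (collapsedTrace W E x) = μ ∧
          ∀ v, ν v ≤ D * μ v ∧ μ v ≤ D * ν v) := by
  set T : Finset (Option {y : S // y ∉ E}) := Finset.univ.erase none with hTdef
  have hT : insert none T = Finset.univ := Finset.insert_erase (Finset.mem_univ _)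
  have hnT : none ∉ T := Finset.notMem_erase _ _
  have hC : 1 ≤ a⁻¹ := (one_le_inv₀ ha).2 ha1
  have hC0 : 0 < a⁻¹ := inv_pos.2 ha
  obtain ⟨D, hD, hcomp⟩ := (balancedComparison T).insert_aux hnT a⁻¹ hC
  refine ⟨D, hD, fun P W hP hW hhit hexit => ?_⟩
  set Q := collapsedTrace W E x with hQdef
  set Q' := collapseMatrix P W E x with hQ'def
  have hQ : Q ∈ Matrix.rowStochastic ℝ _ := hW.collapsedTrace_mem hP hx
  have hQ' : Q' ∈ Matrix.rowStochastic ℝ _ := hW.collapseMatrix_mem hP hx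
  have hW1 : ∀ t, W t x ≤ 1 := fun t => by
    rw [← hW.sum_representative hP hx t]
    exact Finset.single_le_sum (f := fun v => W t (representative E x v))
      (fun v _ => hW.nonneg_trace _ _) (Finset.mem_univ none)
  have hmul : ∀ r : ℝ, 0 ≤ r → r ≤ a⁻¹ * r := fun r hr => le_mul_of_one_le_left hr hC
  have hsplit : ∀ y : S, ∑ z ∈ E, P y z = P y x + ∑ t ∈ E.erase x, P y t :=
    fun y => (Finset.add_sum_erase E _ hx).symm
  have hcol : ∀ y, Q y none ≤ a⁻¹ * Q' y none := by
    rintro (_ | y)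
    · exact hmul _ (hQ.1 _ _)
    · refine le_trans ?_ (hmul _ (hQ'.1 _ _))
      change W y x ≤ ∑ z ∈ E, P y z
      rw [hsplit, hW.first_step]
      gcongr with t ht
      exact mul_le_of_le_one_right (hW.nonneg _ _) (hW1 t)
  have hcol' : ∀ y, Q' y none ≤ a⁻¹ * Q y none := by
    rintro (_ | y)
    · exact hmul _ (hQ'.1 _ _)
    · change ∑ z ∈ E, P y z ≤ a⁻¹ * W y x
      rw [hsplit, hW.first_step, mul_add, Finset.mul_sum]
      refine add_le_add (hmul _ (hW.nonneg _ _)) (Finset.sum_le_sum fun t ht => ?_)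
      calc P y t = a⁻¹ * (P y t * a) := by field_simp
        _ ≤ a⁻¹ * (P y t * W t x) := by
          have := hW.nonneg y t
          gcongr
          exact hhit t ht
  -- The trace jump y → E \ {x} → z is bounded by the detour via ∪E, since exits from t are at most
  -- a⁻¹ times exits from x. Dividing by r ≤ 1 only enlarges the detour.
  have hh : ∀ y z, Q y z ≤ a⁻¹ * eliminate T none Q' y z := by
    have hle : ∀ y z, a⁻¹ * Q' y z ≤ a⁻¹ * eliminate T none Q' y z := fun y z => by
      gcongr; exact le_eliminate hQ'.1 y z
    rintro (_ | y) (_ | z)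
    · exact (hcol none).trans (hle _ _)
    · exact (hmul _ (hQ.1 _ _)).trans (hle none (some z))
    · exact (hcol (some y)).trans (hle _ _)
    · set r := ∑ w ∈ T, Q' none w with hr
      have hr1 : r ≤ 1 := by
        rw [← Matrix.sum_row_of_mem_rowStochastic hQ' none]
        exact Finset.sum_le_sum_of_subset_of_nonneg (Finset.subset_univ _) fun _ _ _ => hQ'.1 _ _
      have hzr : Q' none (some z) ≤ r := Finset.single_le_sum (f := fun w => Q' none w)
        (fun w _ => hQ'.1 none w) (Finset.mem_erase.2 ⟨by simp, Finset.mem_univ _⟩)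
      have hdiv : Q' (some y) none * Q' none (some z) ≤
          Q' (some y) none * Q' none (some z) / r := by
        rcases (hQ'.1 none (some z)).eq_or_lt with h0 | h0
        · rw [← h0, mul_zero, zero_div]
        · rw [le_div_iff₀ (h0.trans_le hzr)]
          exact mul_le_of_le_one_right (mul_nonneg (hQ'.1 _ _) (hQ'.1 _ _)) hr1
      change W y z ≤ a⁻¹ * (P y z + Q' (some y) none * Q' none (some z) / r)
      calc W y z = P y z + ∑ t ∈ E.erase x, P y t * W t z := hW.first_step _ _
        _ ≤ a⁻¹ * P y z + ∑ t ∈ E.erase x, P y t * (a⁻¹ * W x z) := by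
          refine add_le_add (hmul _ (hW.nonneg _ _)) (Finset.sum_le_sum fun t ht => ?_)
          refine mul_le_mul_of_nonneg_left ?_ (hW.nonneg _ _)
          rw [← div_eq_inv_mul, le_div_iff₀ ha, mul_comm]
          exact hexit t ht z
        _ = a⁻¹ * (P y z + (∑ t ∈ E.erase x, P y t) * W x z) := by
          rw [← Finset.sum_mul]; ring
        _ ≤ a⁻¹ * (P y z + Q' (some y) none * Q' none (some z)) := by
          have hle' : ∑ t ∈ E.erase x, P y t ≤ Q' (some y) none := by
            change _ ≤ ∑ t ∈ E, P y t
            rw [hsplit]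
            exact le_add_of_nonneg_left (hW.nonneg _ _)
          have := hW.nonneg_trace x z
          change _ ≤ a⁻¹ * (P y z + Q' (some y) none * W x z)
          gcongr
        _ ≤ _ := by gcongr
  have hh' : ∀ y z, Q' y z ≤ a⁻¹ * eliminate T none Q y z := by
    have hle : ∀ y z, a⁻¹ * Q y z ≤ a⁻¹ * eliminate T none Q y z := fun y z => by
      gcongr; exact le_eliminate hQ.1 y z
    rintro (_ | y) (_ | z)
    · exact (hcol' none).trans (hle _ _)
    · exact (hmul _ (hQ'.1 _ _)).trans (hle none (some z))
    · exact (hcol' (some y)).trans (hle _ _)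
    · refine le_trans ?_ (hle (some y) (some z))
      exact le_trans (hW.le y z) (hmul _ (hW.nonneg_trace _ _))
  constructor
  · intro μ hμ hst
    obtain ⟨ν, hν, hbal, hνμ⟩ := hcomp Q Q' μ hQ.1 hQ'.1 (fun z => hmul _ (hQ'.1 none z))
      (fun z => hmul _ (hQ.1 none z)) hcol hcol' hh hh' hμ
      (by rw [hT]; exact (isBalanced_univ_iff hQ μ).2 hst)
    rw [hT] at hbal hνμ
    exact ⟨ν, hν, (isBalanced_univ_iff hQ' ν).1 hbal, fun v => hνμ v (Finset.mem_univ v)⟩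
  · intro ν hν hst
    obtain ⟨μ, hμ, hbal, hνμ⟩ := hcomp Q' Q ν hQ'.1 hQ.1 (fun z => hmul _ (hQ.1 none z))
      (fun z => hmul _ (hQ'.1 none z)) hcol' hcol hh' hh hν
      (by rw [hT]; exact (isBalanced_univ_iff hQ' ν).2 hst)
    rw [hT] at hbal hνμ
    exact ⟨μ, hμ, (isBalanced_univ_iff hQ μ).1 hbal, fun v =>
      ⟨(hνμ v (Finset.mem_univ v)).2, (hνμ v (Finset.mem_univ v)).1⟩⟩

/-- Comparison of the stationary distributions of a chain and of its collapse. -/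
theorem exists_compare_stationary (hx : x ∈ E) {a : ℝ} (ha : 0 < a) (ha1 : a ≤ 1) :
    ∃ D : ℝ, 0 < D ∧ ∀ P W : Matrix S S ℝ, P ∈ Matrix.rowStochastic ℝ S →
      IsTrace P W (E.erase x) → (∀ t ∈ E.erase x, a ≤ W t x) →
      (∀ t ∈ E.erase x, ∀ z, a * W t z ≤ W x z) →
      (∀ μ : S → ℝ, (∀ s, 0 ≤ μ s) → Matrix.vecMul μ P = μ → ∀ t ∈ E, a * μ t ≤ μ x) →
      (∀ μ ∈ stdSimplex ℝ S, Matrix.vecMul μ P = μ →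
        ∃ ν ∈ stdSimplex ℝ (Option {y : S // y ∉ E}),
          Matrix.vecMul ν (collapseMatrix P W E x) = ν ∧
          ∀ v, ν v ≤ D * μ (representative E x v) ∧ μ (representative E x v) ≤ D * ν v) ∧
      (∀ ν ∈ stdSimplex ℝ (Option {y : S // y ∉ E}),
        Matrix.vecMul ν (collapseMatrix P W E x) = ν →
        ∃ μ ∈ stdSimplex ℝ S, Matrix.vecMul μ P = μ ∧
          ∀ v, ν v ≤ D * μ (representative E x v) ∧ μ (representative E x v) ≤ D * ν v) := by
  obtain ⟨D, hD, hcomp⟩ := exists_compare_collapse hx ha ha1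
  have hD0 : 0 < D := by linarith
  -- Each state of E \ {x} carries at most a⁻¹ times the mass of x, so M bounds total mass by mass
  -- on the representatives.
  set M : ℝ := 1 + (E.erase x).card * a⁻¹ with hM
  have hM1 : 1 ≤ M := le_add_of_nonneg_right (by positivity)
  have hDM : D ^ 2 ≤ D ^ 2 * M := le_mul_of_one_le_right (by positivity) hM1
  refine ⟨D ^ 2 * M, by positivity, fun P W hP hW hhit hexit hstat => ?_⟩
  obtain ⟨hfwd, hbwd⟩ := hcomp P W hP hW hhit hexit
  have htot : ∀ μ : S → ℝ, (∀ s, 0 ≤ μ s) → Matrix.vecMul μ P = μ →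
      ∑ s, μ s ≤ M * ∑ v, μ (representative E x v) := by
    intro μ hμ hst
    have hxle : μ x ≤ ∑ v, μ (representative E x v) :=
      Finset.single_le_sum (f := fun v => μ (representative E x v)) (fun v _ => hμ _)
        (Finset.mem_univ none)
    have hF : ∑ t ∈ E.erase x, μ t ≤ (E.erase x).card * (a⁻¹ * μ x) := by
      rw [← nsmul_eq_mul]
      refine Finset.sum_le_card_nsmul _ _ _ fun t ht => ?_
      rw [← div_eq_inv_mul, le_div_iff₀ ha, mul_comm]
      exact hstat μ hμ hst t (Finset.mem_of_mem_erase ht)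
    rw [sum_eq_sum_representative hx, hM, add_mul, one_mul]
    refine add_le_add le_rfl (hF.trans ?_)
    rw [← mul_assoc]
    gcongr
  constructor
  · rintro μ ⟨hμ, hμ1⟩ hst
    obtain ⟨ν, hν, hνst, hνμ⟩ := hfwd (μ ∘ representative E x) (fun v => hμ _)
      (hW.vecMul_collapsedTrace hx hst)
    have h1 := htot μ hμ hst
    rw [hμ1] at h1
    have h2 : ∑ v, μ (representative E x v) ≤ D * ∑ v, ν v := by
      rw [Finset.mul_sum]; exact Finset.sum_le_sum fun v _ => (hνμ v).2
    have h3 : ∑ v, ν v ≤ D := by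
      calc ∑ v, ν v ≤ D * ∑ v, μ (representative E x v) := by
            rw [Finset.mul_sum]; exact Finset.sum_le_sum fun v _ => (hνμ v).1
        _ ≤ D * 1 := by
            gcongr
            rw [← hμ1, sum_eq_sum_representative hx]
            exact le_add_of_nonneg_right (Finset.sum_nonneg fun t _ => hμ t)
        _ = D := mul_one D
    have h4 : 1 ≤ D * M * ∑ v, ν v := by
      calc (1 : ℝ) ≤ M * (D * ∑ v, ν v) := h1.trans (by gcongr)
        _ = _ := by ring
    have hpos : 0 < ∑ v, ν v := by
      by_contra hc
      have : ∑ v, ν v = 0 := le_antisymm (not_lt.1 hc) (Finset.sum_nonneg fun v _ => hν v)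
      rw [this, mul_zero] at h4
      linarith
    obtain ⟨hs1, hs2⟩ := normalize_mem_stdSimplex hν hpos hνst
    refine ⟨_, hs1, hs2, fun v => ⟨?_, ?_⟩⟩
    · rw [div_le_iff₀ hpos]
      have hμv := hμ (representative E x v)
      calc ν v ≤ D * μ (representative E x v) := (hνμ v).1
        _ ≤ D * μ (representative E x v) * (D * M * ∑ v, ν v) :=
          le_mul_of_one_le_right (by positivity) h4
        _ = _ := by ring
    · rw [← mul_div_assoc, le_div_iff₀ hpos]
      have hμv := hμ (representative E x v)
      have hνv := hν v
      calc μ (representative E x v) * ∑ z, ν z ≤ (D * ν v) * D :=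
            mul_le_mul (hνμ v).2 h3 hpos.le (by positivity)
        _ = D ^ 2 * ν v := by ring
        _ ≤ _ := by gcongr
  · rintro ν ⟨hν, hν1⟩ hst
    obtain ⟨μ', hμ', hμst', hνμ⟩ := hbwd ν hν hst
    obtain ⟨μ, hμ, hμst, rfl⟩ := hW.exists_vecMul_eq hx hμ' hμst'
    have h1 := htot μ hμ hμst
    have h2 : ∑ v, μ (representative E x v) ≤ D := by
      calc ∑ v, μ (representative E x v) ≤ D * ∑ v, ν v := by
            rw [Finset.mul_sum]; exact Finset.sum_le_sum fun v _ => (hνμ v).2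
        _ = D := by rw [hν1, mul_one]
    have h3 : ∑ s, μ s ≤ D * M := by
      calc ∑ s, μ s ≤ M * D := h1.trans (by gcongr)
        _ = _ := mul_comm _ _
    have h4 : 1 ≤ D * ∑ s, μ s := by
      calc (1 : ℝ) = ∑ v, ν v := hν1.symm
        _ ≤ D * ∑ v, μ (representative E x v) := by
          rw [Finset.mul_sum]; exact Finset.sum_le_sum fun v _ => (hνμ v).1
        _ ≤ D * ∑ s, μ s := by
          gcongr
          rw [sum_eq_sum_representative hx μ]
          exact le_add_of_nonneg_right (Finset.sum_nonneg fun t _ => hμ t)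
    have hpos : 0 < ∑ s, μ s := by
      by_contra hc
      have : ∑ s, μ s = 0 := le_antisymm (not_lt.1 hc) (Finset.sum_nonneg fun v _ => hμ v)
      rw [this, mul_zero] at h4
      linarith
    obtain ⟨hs1, hs2⟩ := normalize_mem_stdSimplex hμ hpos hμst
    refine ⟨_, hs1, hs2, fun v => ⟨?_, ?_⟩⟩
    · rw [← mul_div_assoc, le_div_iff₀ hpos]
      have hμv := hμ (representative E x v)
      calc ν v * ∑ z, μ z ≤ (D * μ (representative E x v)) * (D * M) :=
            mul_le_mul (hνμ v).1 h3 hpos.le (by positivity)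
        _ = _ := by ring
    · rw [div_le_iff₀ hpos]
      have hνv := hν v
      calc μ (representative E x v) ≤ D * ν v := (hνμ v).2
        _ ≤ D * ν v * (D * ∑ s, μ s) := le_mul_of_one_le_right (by positivity) h4
        _ = D ^ 2 * ν v * ∑ s, μ s := by ring
        _ ≤ _ := by gcongr

end Collapse

/-! ### Asymptotics near zero -/

lemma eventually_nearZero_iff {I : Set ℝ} (hI : ∀ ε ∈ I, 0 < ε) {p : I → Prop} :
    (∀ᶠ ε in nearZero I, p ε) ↔ ∃ δ : ℝ, 0 < δ ∧ ∀ ε : I, (ε : ℝ) < δ → p ε := by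
  rw [nearZero, (Metric.nhds_basis_ball.comap _).eventually_iff]
  refine exists_congr fun δ => and_congr_right fun _ => forall_congr' fun ε => ?_
  rw [Set.mem_preimage, Metric.mem_ball, Real.dist_eq, sub_zero, abs_of_pos (hI ε ε.2)]

lemma dominated_iff {I : Set ℝ} (hI : ∀ ε ∈ I, 0 < ε) {f g : I → ℝ} :
    Dominated f g ↔ ∃ b : ℝ, 0 < b ∧ ∀ᶠ ε in nearZero I, f ε ≤ b * g ε := by
  simp only [eventually_nearZero_iff hI]
  rfl

/-- The bound M matters because a real `sSup` of a set unbounded above is 0. -/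
lemma liminf_pos_iff {α : Type*} {l : Filter α} [l.NeBot] {f : α → ℝ} {M : ℝ}
    (hf : ∀ᶠ a in l, f a ≤ M) : 0 < liminf f l ↔ ∃ c : ℝ, 0 < c ∧ ∀ᶠ a in l, c ≤ f a := by
  rw [liminf_eq]
  constructor
  · intro h
    have hne : {a | ∀ᶠ n in l, a ≤ f n}.Nonempty := by
      by_contra hc
      rw [Set.not_nonempty_iff_eq_empty] at hc
      rw [hc, Real.sSup_empty] at h
      exact lt_irrefl _ h
    obtain ⟨c, hc, hc0⟩ := exists_lt_of_lt_csSup hne h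
    exact ⟨c, hc0, hc⟩
  · rintro ⟨c, hc0, hc⟩
    refine hc0.trans_le (le_csSup ⟨M, fun a ha => ?_⟩ hc)
    obtain ⟨n, h1, h2⟩ := (Eventually.and ha hf).exists
    exact h1.trans h2

lemma isStableOn_iff {S : Type*} [Fintype S] {I : Set ℝ} [(nearZero I).NeBot] {J : Set I}
    (hJ : J ∈ nearZero I) {q : I → Matrix S S ℝ} {y : S} :
    IsStableOn J q y ↔ ∃ μ : I → S → ℝ, IsStationaryMapOn J q μ ∧
      ∃ c : ℝ, 0 < c ∧ ∀ᶠ ε in nearZero I, c ≤ μ ε y := by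
  refine exists_congr fun μ => and_congr_right fun hμ => liminf_pos_iff (M := 1) ?_
  filter_upwards [hJ] with ε hε
  obtain ⟨h0, h1⟩ := (hμ ε hε).1
  rw [← h1]
  exact Finset.single_le_sum (fun s _ => h0 s) (Finset.mem_univ y)

/-- An eventual solution of the stationarity equations extends to `J`. -/
lemma exists_isStationaryMapOn {V : Type*} [Fintype V] [DecidableEq V] [Nonempty V] {I : Set ℝ}
    {J : Set I} {q : I → Matrix V V ℝ} (hq : IsStochasticOn J q) {r : I → (V → ℝ) → Prop}
    (h : ∀ᶠ ε in nearZero I, ε ∈ J →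
      ∃ ν ∈ stdSimplex ℝ V, Matrix.vecMul ν (q ε) = ν ∧ r ε ν) :
    ∃ ν : I → V → ℝ, IsStationaryMapOn J q ν ∧ ∀ᶠ ε in nearZero I, ε ∈ J → r ε (ν ε) := by
  -- Choose a solution satisfying r wherever one exists, and any stationary distribution at the
  -- other parameters of J.
  have hex : ∀ ε : I, ∃ ν : V → ℝ, ε ∈ J → (ν ∈ stdSimplex ℝ V ∧ Matrix.vecMul ν (q ε) = ν) ∧
      ((∃ ν ∈ stdSimplex ℝ V, Matrix.vecMul ν (q ε) = ν ∧ r ε ν) → r ε ν) := by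
    intro ε
    by_cases hr : ∃ ν ∈ stdSimplex ℝ V, Matrix.vecMul ν (q ε) = ν ∧ r ε ν
    · obtain ⟨ν, h1, h2, h3⟩ := hr
      exact ⟨ν, fun _ => ⟨⟨h1, h2⟩, fun _ => h3⟩⟩
    · by_cases hε : ε ∈ J
      · obtain ⟨ν, h1, h2⟩ := exists_stationary (hq ε hε)
        exact ⟨ν, fun _ => ⟨⟨h1, h2⟩, fun h => absurd h hr⟩⟩
      · exact ⟨0, fun h => absurd h hε⟩
  choose ν hν using hex
  refine ⟨ν, fun ε hε => (hν ε hε).1, ?_⟩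
  filter_upwards [h] with ε h hε
  exact (hν ε hε).2 (h hε)

/-! ### Uniform comparison for the essential collapse -/

namespace Perturbation

variable {S : Type*} [Fintype S] [DecidableEq S] (X : Perturbation S)

lemma neBot_nearZero : (nearZero X.I).NeBot := by
  rw [nearZero, comap_neBot_iff_frequently]
  have h := accPt_iff_frequently.1 X.limitPoint
  exact h.mono fun ε hε => ⟨⟨ε, hε.2⟩, rfl⟩

/-- The probabilities of the essential arcs are bounded away from zero. -/
lemma exists_le_of_essentialArc :
    ∃ c : ℝ, 0 < c ∧ ∀ᶠ ε in nearZero X.I, ∀ s t, X.EssentialArc s t → c ≤ X.p ε s t := by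
  have hex : ∀ i : S × S, ∃ c : ℝ, 0 < c ∧
      (X.EssentialArc i.1 i.2 → ∀ᶠ ε in nearZero X.I, c ≤ X.p ε i.1 i.2) := by
    rintro ⟨s, t⟩
    by_cases harc : X.EssentialArc s t
    · have hdom := fun z => (dominated_iff X.pos).1 (harc.2 s z)
      choose b hb hle using hdom
      have hbpos : 0 < ∑ z, b z := Finset.sum_pos (fun z _ => hb z) ⟨s, Finset.mem_univ s⟩
      refine ⟨(∑ z, b z)⁻¹, inv_pos.2 hbpos, fun _ => ?_⟩
      filter_upwards [eventually_all.2 hle] with ε hε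
      rw [inv_le_iff_one_le_mul₀ hbpos,
        ← Matrix.sum_row_of_mem_rowStochastic (X.stochastic ε) s, mul_comm, Finset.sum_mul]
      exact Finset.sum_le_sum fun z _ => hε z
    · exact ⟨1, one_pos, fun h => absurd h harc⟩
  obtain ⟨c, hc, h⟩ := exists_pos_forall_of_antitone
    (fun i a a' _ haa' h harc => (h harc).mono fun ε hε => haa'.trans hε) hex
  refine ⟨c, hc, eventually_all.2 fun s => eventually_all.2 fun t => ?_⟩
  by_cases harc : X.EssentialArc s t
  · exact (h (s, t) harc).mono fun ε hε _ => hε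
  · exact Eventually.of_forall fun ε h => absurd h harc

variable {X} {E : Finset S} {x : S}

lemma collapse_eq_collapseMatrix (ε : X.I) :
    X.collapse E x ε = collapseMatrix (X.p ε) (traceMatrix (X.p ε) (E.erase x)) E x := by
  have hset : ({y | y ∉ E} ∪ {x} : Set S) = {s | s ∉ E.erase x} := by
    ext s
    simp only [Set.mem_union, Set.mem_ofPred_eq, Set.mem_singleton_iff, Finset.mem_erase]
    tauto
  have hval : ∀ v, hitProb (X.p ε) (X.stochastic ε) x ({y | y ∉ E} ∪ {x})
      (representative E x v) =
        traceMatrix (X.p ε) (E.erase x) x (representative E x v) := by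
    intro v
    rw [hset, traceMatrix_eq_hitProb (X.stochastic ε)]
    rcases v with _ | y
    · exact Finset.notMem_erase x E
    · exact fun h => y.2 (Finset.mem_of_mem_erase h)
  ext u v
  rcases u with _ | y <;> rcases v with _ | z
  · exact hval none
  · exact hval (some z)
  · rfl
  · rfl

/-- Near zero, the stationary distributions of a perturbation and of its essential collapse
correspond to each other, and they are of constant order on the essential class. -/
theorem exists_collapse_comparison (hE : X.IsEssentialClass E) (hx : x ∈ E) :
    ∃ D : ℝ, 0 < D ∧ ∀ᶠ ε in nearZero X.I,
      X.collapse E x ε ∈ Matrix.rowStochastic ℝ (Option {y : S // y ∉ E}) ∧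
      (∀ μ ∈ stdSimplex ℝ S, Matrix.vecMul μ (X.p ε) = μ →
        ∃ ν ∈ stdSimplex ℝ (Option {y : S // y ∉ E}),
          Matrix.vecMul ν (X.collapse E x ε) = ν ∧
          ∀ v, ν v ≤ D * μ (representative E x v) ∧ μ (representative E x v) ≤ D * ν v) ∧
      (∀ ν ∈ stdSimplex ℝ (Option {y : S // y ∉ E}), Matrix.vecMul ν (X.collapse E x ε) = ν →
        ∃ μ ∈ stdSimplex ℝ S, Matrix.vecMul μ (X.p ε) = μ ∧
          ∀ v, ν v ≤ D * μ (representative E x v) ∧ μ (representative E x v) ≤ D * ν v) ∧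
      (∀ μ ∈ stdSimplex ℝ S, Matrix.vecMul μ (X.p ε) = μ →
        ∀ t ∈ E, μ t ≤ D * μ x ∧ μ x ≤ D * μ t) := by
  obtain ⟨c, hc, harc⟩ := X.exists_le_of_essentialArc
  have hto : ∀ t ∈ E, X.EssentialReach t x := fun t ht => ((hE.isSCC t ht x).1 hx).1
  have hfrom : ∀ t ∈ E, X.EssentialReach x t := fun t ht => ((hE.isSCC t ht x).1 hx).2
  obtain ⟨a₁, ha₁, h₁⟩ := exists_pos_forall_of_antitone (ι := S)
    (p := fun t a => t ∈ E → ∀ P W : Matrix S S ℝ, IsTrace P W (E.erase x) →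
      (∀ s t, X.EssentialArc s t → c ≤ P s t) → t ≠ x → a ≤ W t x)
    (fun t a a' _ haa' h ht P W hW hR htx => haa'.trans (h ht P W hW hR htx))
    (fun t => by
      by_cases ht : t ∈ E
      · obtain ⟨a, ha, h⟩ := IsTrace.exists_le_hit hc hE.sink ht (hto t ht)
        exact ⟨a, ha, fun _ => h⟩
      · exact ⟨1, one_pos, fun h => absurd h ht⟩)
  obtain ⟨a₂, ha₂, h₂⟩ := exists_pos_forall_of_antitone (ι := S)
    (p := fun t a => t ∈ E → ∀ P W : Matrix S S ℝ, IsTrace P W (E.erase x) →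
      (∀ s t, X.EssentialArc s t → c ≤ P s t) → ∀ z, a * W t z ≤ W x z)
    (fun t a a' _ haa' h ht P W hW hR z =>
      (mul_le_mul_of_nonneg_right haa' (hW.nonneg_trace t z)).trans (h ht P W hW hR z))
    (fun t => by
      by_cases ht : t ∈ E
      · obtain ⟨a, ha, h⟩ := IsTrace.exists_mul_le (x := x) hc hE.sink hx (hfrom t ht)
        exact ⟨a, ha, fun _ P W hW hR z => (h P W hW hR z).elim id id⟩
      · exact ⟨1, one_pos, fun h => absurd h ht⟩)
  obtain ⟨a₃, ha₃, h₃⟩ := exists_pos_forall_of_antitone (ι := S)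
    (p := fun t a => t ∈ E → ∀ (P : Matrix S S ℝ) (μ : S → ℝ), (∀ s t, 0 ≤ P s t) →
      (∀ s t, X.EssentialArc s t → c ≤ P s t) → (∀ s, 0 ≤ μ s) → Matrix.vecMul μ P = μ →
      a * μ t ≤ μ x ∧ a * μ x ≤ μ t)
    (fun t a a' _ haa' h ht P μ hP hR hμ hst =>
      ⟨(mul_le_mul_of_nonneg_right haa' (hμ t)).trans (h ht P μ hP hR hμ hst).1,
        (mul_le_mul_of_nonneg_right haa' (hμ x)).trans (h ht P μ hP hR hμ hst).2⟩)
    (fun t => by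
      by_cases ht : t ∈ E
      · obtain ⟨a, ha, h⟩ := exists_mul_le_stationary hc (hto t ht)
        obtain ⟨a', ha', h'⟩ := exists_mul_le_stationary hc (hfrom t ht)
        refine ⟨min a a', lt_min ha ha', fun _ P μ hP hR hμ hst => ⟨?_, ?_⟩⟩
        · exact (mul_le_mul_of_nonneg_right (min_le_left _ _) (hμ t)).trans
            (h P μ hP hR hμ hst)
        · exact (mul_le_mul_of_nonneg_right (min_le_right _ _) (hμ x)).trans
            (h' P μ hP hR hμ hst)
      · exact ⟨1, one_pos, fun h => absurd h ht⟩)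
  set a := min (min 1 a₁) (min a₂ a₃) with hadef
  have ha : 0 < a := lt_min (lt_min one_pos ha₁) (lt_min ha₂ ha₃)
  have hle1 : a ≤ 1 := (min_le_left _ _).trans (min_le_left _ _)
  have hle₁ : a ≤ a₁ := (min_le_left _ _).trans (min_le_right _ _)
  have hle₂ : a ≤ a₂ := (min_le_right _ _).trans (min_le_left _ _)
  have hle₃ : a ≤ a₃ := (min_le_right _ _).trans (min_le_right _ _)
  obtain ⟨D, hD, hcomp⟩ := exists_compare_stationary hx ha hle1
  -- D serves the comparison with the collapse, a⁻¹ the comparison of masses inside E.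
  refine ⟨max D a⁻¹, lt_max_of_lt_left hD, ?_⟩
  filter_upwards [harc] with ε hε
  have hP := X.stochastic ε
  have hW : IsTrace (X.p ε) (traceMatrix (X.p ε) (E.erase x)) (E.erase x) :=
    isTrace_traceMatrix hP fun t ht => ⟨x, Finset.notMem_erase x E,
      Relation.ReflTransGen.mono (fun s u hsu => hc.trans_le (hε s u hsu)) _ _
        (hto t (Finset.mem_of_mem_erase ht))⟩
  have hst : ∀ μ : S → ℝ, (∀ s, 0 ≤ μ s) → Matrix.vecMul μ (X.p ε) = μ →
      ∀ t ∈ E, a * μ t ≤ μ x ∧ a * μ x ≤ μ t := fun μ hμ hst t ht =>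
    ⟨(mul_le_mul_of_nonneg_right hle₃ (hμ t)).trans (h₃ t ht _ μ hP.1 hε hμ hst).1,
      (mul_le_mul_of_nonneg_right hle₃ (hμ x)).trans (h₃ t ht _ μ hP.1 hε hμ hst).2⟩
  obtain ⟨hfwd, hbwd⟩ := hcomp _ _ hP hW
    (fun t ht => hle₁.trans (h₁ t (Finset.mem_of_mem_erase ht) _ _ hW hε
      (Finset.ne_of_mem_erase ht)))
    (fun t ht z => (mul_le_mul_of_nonneg_right hle₂ (hW.nonneg_trace t z)).trans
      (h₂ t (Finset.mem_of_mem_erase ht) _ _ hW hε z))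
    (fun μ hμ hμst t ht => (hst μ hμ hμst t ht).1)
  rw [collapse_eq_collapseMatrix ε]
  refine ⟨hW.collapseMatrix_mem hP hx, fun μ hμ hμst => ?_, fun ν hν hνst => ?_,
    fun μ hμ hμst t ht => ?_⟩
  · obtain ⟨ν, hν, hνst, h⟩ := hfwd μ hμ hμst
    exact ⟨ν, hν, hνst, fun v =>
      ⟨(h v).1.trans (mul_le_mul_of_nonneg_right (le_max_left _ _) (hμ.1 _)),
        (h v).2.trans (mul_le_mul_of_nonneg_right (le_max_left _ _) (hν.1 _))⟩⟩
  · obtain ⟨μ, hμ, hμst, h⟩ := hbwd ν hν hνst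
    exact ⟨μ, hμ, hμst, fun v =>
      ⟨(h v).1.trans (mul_le_mul_of_nonneg_right (le_max_left _ _) (hμ.1 _)),
        (h v).2.trans (mul_le_mul_of_nonneg_right (le_max_left _ _) (hν.1 _))⟩⟩
  · have key : ∀ u v : ℝ, 0 ≤ v → a * u ≤ v → u ≤ max D a⁻¹ * v := fun u v hv h => by
      refine le_trans ?_ (mul_le_mul_of_nonneg_right (le_max_right D a⁻¹) hv)
      rw [← div_eq_inv_mul, le_div_iff₀ ha, mul_comm]
      exact h
    exact ⟨key _ _ (hμ.1 x) (hst μ hμ.1 hμst t ht).1, key _ _ (hμ.1 t) (hst μ hμ.1 hμst t ht).2⟩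

end Perturbation

/-! ### The main theorem -/

theorem mainTheorem6 {S : Type*} [Fintype S] [DecidableEq S] (X : Perturbation S)
    (hX : X.TotallyPreordered) (E : Finset S) (hE : X.IsEssentialClass E) (x : S) (hx : x ∈ E) :
    -- close to `0` the essential collapse consists of stochastic matrices
    (∃ δ : ℝ, 0 < δ ∧ IsStochasticOn {ε : X.I | (ε : ℝ) < δ} (X.collapse E x)) ∧
    -- on every neighborhood `J` of `0` in `I` where it does (`J = I` included):
    ∀ J ∈ nearZero X.I, IsStochasticOn J (X.collapse E x) →
      (∀ μ : X.I → S → ℝ, IsStationaryMapOn J X.p μ →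
        ∃ ν : X.I → Option {y : S // y ∉ E} → ℝ, IsStationaryMapOn J (X.collapse E x) ν ∧
          Equivalent (fun ε => ν ε none) (fun ε => μ ε x) ∧
          ∀ y : {y : S // y ∉ E}, Equivalent (fun ε => ν ε (some y)) (fun ε => μ ε y)) ∧
      (∀ ν : X.I → Option {y : S // y ∉ E} → ℝ, IsStationaryMapOn J (X.collapse E x) ν →
        ∃ μ : X.I → S → ℝ, IsStationaryMapOn J X.p μ ∧
          Equivalent (fun ε => ν ε none) (fun ε => μ ε x) ∧
          ∀ y : {y : S // y ∉ E}, Equivalent (fun ε => ν ε (some y)) (fun ε => μ ε y)) ∧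
      ∀ y : S, IsStableOn Set.univ X.p y ↔
        (y ∈ E ∧ IsStableOn J (X.collapse E x) none) ∨
          ∃ hy : y ∉ E, IsStableOn J (X.collapse E x) (some ⟨y, hy⟩) := by
  have := X.neBot_nearZero
  have : Nonempty S := ⟨x⟩
  obtain ⟨D, hD, hcomp⟩ := Perturbation.exists_collapse_comparison hE hx
  refine ⟨?_, fun J hJ hJs => ?_⟩
  · exact (eventually_nearZero_iff X.pos).1 (hcomp.mono fun ε h => h.1)
  have hequiv : ∀ (μ : X.I → S → ℝ) (ν : X.I → Option {y : S // y ∉ E} → ℝ),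
      (∀ᶠ ε in nearZero X.I, ∀ v, ν ε v ≤ D * μ ε (representative E x v) ∧
        μ ε (representative E x v) ≤ D * ν ε v) →
      ∀ v, Equivalent (fun ε => ν ε v) (fun ε => μ ε (representative E x v)) := fun μ ν h v =>
    ⟨(dominated_iff X.pos).2 ⟨D, hD, h.mono fun ε hε => (hε v).1⟩,
      (dominated_iff X.pos).2 ⟨D, hD, h.mono fun ε hε => (hε v).2⟩⟩
  have hfwd : ∀ μ : X.I → S → ℝ, IsStationaryMapOn J X.p μ →
      ∃ ν : X.I → Option {y : S // y ∉ E} → ℝ, IsStationaryMapOn J (X.collapse E x) ν ∧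
        ∀ᶠ ε in nearZero X.I, ∀ v, ν ε v ≤ D * μ ε (representative E x v) ∧
          μ ε (representative E x v) ≤ D * ν ε v := by
    intro μ hμ
    obtain ⟨ν, hν, h⟩ := exists_isStationaryMapOn hJs (r := fun ε ν =>
      ∀ v, ν v ≤ D * μ ε (representative E x v) ∧ μ ε (representative E x v) ≤ D * ν v)
      (hcomp.mono fun ε h hε => h.2.1 _ (hμ ε hε).1 (hμ ε hε).2)
    exact ⟨ν, hν, (h.and hJ).mono fun ε hε => hε.1 hε.2⟩
  -- As p is stochastic on all of I, the map is built there; this gives stability over I, and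
  -- restriction to J gives the converse half of the correspondence.
  have hbwd : ∀ ν : X.I → Option {y : S // y ∉ E} → ℝ,
      IsStationaryMapOn J (X.collapse E x) ν → ∃ μ : X.I → S → ℝ, IsStationaryMapOn Set.univ X.p μ ∧
        ∀ᶠ ε in nearZero X.I, ∀ v, ν ε v ≤ D * μ ε (representative E x v) ∧
          μ ε (representative E x v) ≤ D * ν ε v := by
    intro ν hν
    obtain ⟨μ, hμ, h⟩ := exists_isStationaryMapOn (J := Set.univ) (q := X.p)
      (fun ε _ => X.stochastic ε) (r := fun ε μ =>
      ∀ v, ν ε v ≤ D * μ (representative E x v) ∧ μ (representative E x v) ≤ D * ν ε v)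
      ((hcomp.and hJ).mono fun ε h _ => h.1.2.2.1 _ (hν ε h.2).1 (hν ε h.2).2)
    exact ⟨μ, hμ, h.mono fun ε hε => hε trivial⟩
  have hlower : ∀ {f g : X.I → ℝ}, (∀ᶠ ε in nearZero X.I, f ε ≤ D * g ε) →
      (∃ c : ℝ, 0 < c ∧ ∀ᶠ ε in nearZero X.I, c ≤ f ε) →
      ∃ c : ℝ, 0 < c ∧ ∀ᶠ ε in nearZero X.I, c ≤ g ε := by
    rintro f g hfg ⟨c, hc, h⟩
    refine ⟨c / D, div_pos hc hD, ?_⟩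
    filter_upwards [hfg, h] with ε h1 h2
    rw [div_le_iff₀ hD, mul_comm]
    exact h2.trans h1
  refine ⟨fun μ hμ => ?_, fun ν hν => ?_, fun y => ?_⟩
  · obtain ⟨ν, hν, h⟩ := hfwd μ hμ
    exact ⟨ν, hν, hequiv μ ν h none, fun y => hequiv μ ν h (some y)⟩
  · obtain ⟨μ, hμ, h⟩ := hbwd ν hν
    exact ⟨μ, fun ε _ => hμ ε trivial, hequiv μ ν h none, fun y => hequiv μ ν h (some y)⟩
  · rw [isStableOn_iff univ_mem]
    simp only [isStableOn_iff hJ]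
    constructor
    · rintro ⟨μ, hμ, hpos⟩
      obtain ⟨ν, hν, h⟩ := hfwd μ fun ε _ => hμ ε trivial
      by_cases hy : y ∈ E
      · refine Or.inl ⟨hy, ν, hν, hlower (h.mono fun ε hε => (hε none).2) (hlower ?_ hpos)⟩
        exact hcomp.mono fun ε hε => (hε.2.2.2 _ (hμ ε trivial).1 (hμ ε trivial).2 y hy).1
      · exact Or.inr ⟨hy, ν, hν, hlower (h.mono fun ε hε => (hε (some ⟨y, hy⟩)).2) hpos⟩
    · rintro (⟨hy, ν, hν, hpos⟩ | ⟨hy, ν, hν, hpos⟩)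
      · obtain ⟨μ, hμ, h⟩ := hbwd ν hν
        refine ⟨μ, hμ, hlower ?_ (hlower (h.mono fun ε hε => (hε none).1) hpos)⟩
        exact hcomp.mono fun ε hε => (hε.2.2.2 _ (hμ ε trivial).1 (hμ ε trivial).2 y hy).2
      · obtain ⟨μ, hμ, h⟩ := hbwd ν hν
        exact ⟨μ, hμ, hlower (h.mono fun ε hε => (hε (some ⟨y, hy⟩)).1) hpos⟩
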